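/- Let $W$ be a standard Brownian motion and let $T$ be a random time with a density on $(0,\infty)$, independent of $W$. For $f:(0,\infty)\to\mathbb R$ write $\mathcal M[f](z)=\int_0^\infty f(t)\,t^{z-1}\,dt$ for its Mellin transform. For $\beta,\gamma,L>0$ let $\mathcal C(\beta,\gamma,L)$ and $\mathcal D(\beta,\gamma,L)$ be the sets of all probability densities $f$ on $(0,\infty)$ that are continuous on $(0,\infty)$, satisfy $\int_0^\infty f(t)\,t^{\gamma-1}\,dt<\infty$, and satisfy, respectively, $$\int_{-\infty}^{\infty}\bigl|\mathcal M[f](\gamma+\mathrm i v)\bigr|\,e^{\beta|v|}\,dv<L,\qquad \int_{-\infty}^{\infty}\bigl|\mathcal M[f](\gamma+\mathrm i v)\bigr|\,(1+|v|^{\beta})\,dv<L .$$ (A density whose Mellin transform is integrable along the line $\operatorname{Re} z=\gamma$ has exactly one continuous version on $(0,\infty)$; continuity gives $f(x)$ a meaning at a single point $x$.) **Theorem.** Let $\beta>1$, $\gamma>0$ and $L>0$. There are $\varepsilon>0$, $x>0$ and $\rho>0$ such that $$\liminf_{n\to\infty}\ \inf_{p_n}\ \sup_{p_T\in\mathcal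 C(\beta,\gamma,L)} \mathbb P^{\otimes n}_{p_T}\Bigl(|p_T(x)-p_n(x)|\ge\varepsilon\, n^{-\frac{\beta}{\pi+2\beta}}\log^{-\rho}(n)\Bigr)>0,$$ $$\liminf_{n\to\infty}\ \inf_{p_n}\ \sup_{p_T\in\mathcal D(\beta,\gamma,L)} \mathbb P^{\otimes n}_{p_T}\Bigl(|p_T(x)-p_n(x)|\ge\varepsilon\,\log^{-\beta}(n)\Bigr)>0,$$ where the infimum is over all estimators $p_n$ of $p_T$ (all measurable functions of $X_1,\dots,X_n$), and $\mathbb P^{\otimes n}_{p_T}$ is the law of an i.i.d. sample $X_1,\dots,X_n$ with $X_1\sim W_T$ and $T\sim p_T$. -/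

import Mathlib

open MeasureTheory ProbabilityTheory Filter Set
open scoped ENNReal NNReal Topology

noncomputable section

namespace SkorohodLowerBound

/-- `p` is a probability density on `(0, ∞)` which is continuous there (only the values of `p` on
`(0, ∞)` matter). Every density with integrable Mellin transform on some vertical line has exactly
one such version; the continuity requirement makes the value `p x` at a point meaningful. -/
structure IsDensity (p : ℝ → ℝ) : Prop where
  continuousOn : ContinuousOn p (Ioi 0)
  nonneg : ∀ t ∈ Ioi (0 : ℝ), 0 ≤ p t
  lintegral_eq_one : ∫⁻ t in Ioi (0 : ℝ), ENNReal.ofReal (p t) = 1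

/-- The law on `ℝ` of a nonnegative random time `T` with density `p` on `(0, ∞)`. -/
def timeLaw (p : ℝ → ℝ) : Measure ℝ :=
  (volume.restrict (Ioi 0)).withDensity fun t => ENNReal.ofReal (p t)

/-- The law of `W_T`, where `T` has density `p` and `W` is a standard Brownian motion independent
of `T`, i.e. the law of `√T * Z` with `Z` standard normal and independent of `T`;
see `map_brownian_eq_stoppedLaw`. -/
def stoppedLaw (p : ℝ → ℝ) : Measure ℝ :=
  ((timeLaw p).prod (gaussianReal 0 1)).map fun q : ℝ × ℝ => √q.1 * q.2

/-- The law of an i.i.d. sample of size `n` from the law of `W_T`, where `T` has density `p`. -/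
def sampleLaw (n : ℕ) (p : ℝ → ℝ) : Measure (Fin n → ℝ) :=
  Measure.pi fun _ => stoppedLaw p

/-- The Mellin transform `∫₀^∞ p(t) t^(z-1) dt` of a real function `p`. -/
def mellinOf (p : ℝ → ℝ) (z : ℂ) : ℂ :=
  mellin (fun t => (p t : ℂ)) z

/-- The densities `p` on `(0, ∞)` whose Mellin transform exists on the line `Re z = γ` and satisfies
`∫ |M[p](γ + i v)| e^{β |v|} dv < L`. -/
def classC (β γ L : ℝ) : Set (ℝ → ℝ) :=
  {p | IsDensity p ∧ MellinConvergent (fun t => (p t : ℂ)) (γ : ℂ) ∧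
    ∫⁻ v : ℝ, ENNReal.ofReal (‖mellinOf p (γ + v * Complex.I)‖ * Real.exp (β * |v|))
      < ENNReal.ofReal L}

/-- The densities `p` on `(0, ∞)` whose Mellin transform exists on the line `Re z = γ` and satisfies
`∫ |M[p](γ + i v)| (1 + |v|^β) dv < L`. -/
def classD (β γ L : ℝ) : Set (ℝ → ℝ) :=
  {p | IsDensity p ∧ MellinConvergent (fun t => (p t : ℂ)) (γ : ℂ) ∧
    ∫⁻ v : ℝ, ENNReal.ofReal (‖mellinOf p (γ + v * Complex.I)‖ * (1 + |v| ^ β))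
      < ENNReal.ofReal L}

/-- The minimax risk at `x` over the class `G`, for the loss `1{|p(x) - est(x)| ≥ r}` and samples of
size `n`: the infimum over all estimators `est`, i.e. measurable maps from samples to functions, of
the supremum over `p ∈ G` of the probability that the error at `x` is at least `r`. -/
def minimaxRisk (G : Set (ℝ → ℝ)) (x : ℝ) (n : ℕ) (r : ℝ) : ℝ≥0∞ :=
  ⨅ (est : (Fin n → ℝ) → ℝ → ℝ) (_ : Measurable est), ⨆ p ∈ G,
    sampleLaw n p {s | r ≤ |p x - est s x|}

/-- Rounding a time down to the grid of mesh `1 / (k + 1)`. -/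
def gridFloor (k : ℕ) (t : ℝ≥0) : ℝ≥0 := (⌊((k : ℝ≥0) + 1) * t⌋₊ : ℝ≥0) / ((k : ℝ≥0) + 1)

theorem tendsto_gridFloor (t : ℝ≥0) : Tendsto (fun k => gridFloor k t) atTop (𝓝 t) := by
  rw [← NNReal.tendsto_coe]
  have h1 : Tendsto (fun k : ℕ => (k : ℝ) + 1) atTop atTop :=
    tendsto_atTop_add_const_right _ _ tendsto_natCast_atTop_atTop
  have h2 := (tendsto_nat_floor_mul_div_atTop (R := ℝ) (a := (t : ℝ)) t.2).comp h1
  refine h2.congr fun k => ?_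
  have h3 : ⌊((k : ℝ≥0) + 1) * t⌋₊ = ⌊(t : ℝ) * ((k : ℝ) + 1)⌋₊ := by
    refine eq_of_forall_le_iff fun m => ?_
    rw [Nat.le_floor_iff (by positivity), Nat.le_floor_iff (by positivity), ← NNReal.coe_le_coe]
    push_cast
    rw [mul_comm]
  simp only [gridFloor, Function.comp, h3]
  push_cast
  rfl

/-- `stoppedLaw p` is the law of `W_T`, for every standard Brownian motion `W` and every independent
random time `T` with density `p`. -/
theorem map_brownian_eq_stoppedLaw {Ω : Type*} [MeasurableSpace Ω] {P : Measure Ω}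
    {W : ℝ≥0 → Ω → ℝ} (hW : IsBrownianReal W P) {T : Ω → ℝ≥0} (hT : Measurable T)
    (hind : IndepFun T (fun ω t => W t ω) P) {p : ℝ → ℝ}
    (hlaw : P.map (fun ω => (T ω : ℝ)) = timeLaw p) :
    HasLaw (fun ω => W (T ω) ω) (stoppedLaw p) P := by
  have hP : IsProbabilityMeasure P := hW.isGaussianProcess.isProbabilityMeasure
  have hTr : Measurable fun ω => (T ω : ℝ) := hT.coe_nnreal_real
  have hpr : IsProbabilityMeasure (timeLaw p) := by
    rw [← hlaw]; exact Measure.isProbabilityMeasure_map hTr.aemeasurable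
  have hφ := tendsto_gridFloor
  let s : ℕ → ℕ → Set Ω := fun k m => {ω | ⌊((k : ℝ≥0) + 1) * T ω⌋₊ = m}
  have hs : ∀ k m, MeasurableSet (s k m) := fun k m =>
    (Nat.measurable_floor.comp (hT.const_mul _)) (measurableSet_singleton m)
  have hsU : ∀ k, ⋃ m, s k m = univ := fun k => by
    ext ω; simp [s]
  have hsd : ∀ k, Pairwise (Function.onFun Disjoint (s k)) := fun k i j hij => by
    rw [Function.onFun, Set.disjoint_left]
    intro ω h h'
    exact hij (h.symm.trans h')
  have hWk : ∀ k, AEMeasurable (fun ω => W (gridFloor k (T ω)) ω) P := by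
    intro k
    rw [← Measure.restrict_univ (μ := P), ← hsU k, aemeasurable_iUnion_iff]
    intro m
    refine (((hW.aemeasurable ((m : ℝ≥0) / (k + 1))).restrict).congr ?_)
    filter_upwards [ae_restrict_mem (hs k m)] with ω hω
    have : ⌊((k : ℝ≥0) + 1) * T ω⌋₊ = m := hω
    simp only [gridFloor, this]
  have hlim : ∀ᵐ ω ∂P, Tendsto (fun k => W (gridFloor k (T ω)) ω) atTop (𝓝 (W (T ω) ω)) := by
    filter_upwards [hW.cont] with ω hω
    exact (hω.tendsto _).comp (hφ _)
  have hWT : AEMeasurable (fun ω => W (T ω) ω) P :=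
    aemeasurable_of_tendsto_metrizable_ae atTop hWk hlim
  refine ⟨hWT, ?_⟩
  have hmul : Measurable fun q : ℝ × ℝ => √q.1 * q.2 := by fun_prop
  have : IsProbabilityMeasure (stoppedLaw p) :=
    Measure.isProbabilityMeasure_map hmul.aemeasurable
  have : IsProbabilityMeasure (P.map fun ω => W (T ω) ω) :=
    Measure.isProbabilityMeasure_map hWT
  refine ext_of_forall_integral_eq_of_IsFiniteMeasure fun f => ?_
  let g : ℝ → ℝ := fun t => ∫ z, f (√t * z) ∂(gaussianReal 0 1)
  have hgc : Continuous g := by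
    refine continuous_of_dominated (bound := fun _ => ‖f‖) ?_ ?_ (integrable_const _) ?_
    · intro t
      exact (f.continuous.comp (by fun_prop)).aestronglyMeasurable
    · intro t
      exact .of_forall fun z => f.norm_coe_le_norm _
    · refine .of_forall fun z => f.continuous.comp (by fun_prop)
  have hgb : ∀ t, ‖g t‖ ≤ ‖f‖ := fun t => by
    refine (norm_integral_le_of_norm_le_const (C := ‖f‖)
      (.of_forall fun z => f.norm_coe_le_norm _)).trans ?_
    simp
  have hgW : ∀ t : ℝ≥0, ∫ ω, f (W t ω) ∂P = g t := by
    intro t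
    have h1 := (hW.hasLaw_eval t).integral_comp (f := f)
      f.continuous.aestronglyMeasurable
    have h2 : (gaussianReal 0 1).map (fun z => √(t : ℝ) * z) = gaussianReal 0 t := by
      rw [gaussianReal_map_const_mul]
      congr 1
      · simp
      · ext; simp
    calc ∫ ω, f (W t ω) ∂P = ∫ z, f z ∂(gaussianReal 0 t) := h1
      _ = g t := by
        rw [← h2, integral_map (by fun_prop) f.continuous.aestronglyMeasurable]
  have hfb : ∀ k, Integrable (fun ω => f (W (gridFloor k (T ω)) ω)) P := fun k =>
    Integrable.of_bound (f.continuous.measurable.comp_aemeasurable (hWk k)).aestronglyMeasurable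
      ‖f‖ (.of_forall fun ω => f.norm_coe_le_norm _)
  have hgm : ∀ k, Measurable fun ω => g (gridFloor k (T ω)) := fun k => by
    refine hgc.measurable.comp (Measurable.coe_nnreal_real ?_)
    exact (measurable_from_nat.comp
      (Nat.measurable_floor.comp (hT.const_mul _)) : Measurable
        ((fun j : ℕ => (j : ℝ≥0) / ((k : ℝ≥0) + 1)) ∘ _))
  have hgi : ∀ k, Integrable (fun ω => g (gridFloor k (T ω))) P := fun k =>
    Integrable.of_bound (hgm k).aestronglyMeasurable ‖f‖ (.of_forall fun ω => hgb _)
  have hk : ∀ k, ∫ ω, f (W (gridFloor k (T ω)) ω) ∂P = ∫ ω, g (gridFloor k (T ω)) ∂P := by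
    intro k
    rw [← setIntegral_univ (f := fun ω => f (W (gridFloor k (T ω)) ω)),
      ← setIntegral_univ (f := fun ω => g (gridFloor k (T ω))), ← hsU k,
      integral_iUnion (hs k) (hsd k) (hfb k).integrableOn,
      integral_iUnion (hs k) (hsd k) (hgi k).integrableOn]
    congr 1
    ext m
    set t : ℝ≥0 := (m : ℝ≥0) / (k + 1) with ht
    have e : ∀ ω ∈ s k m, gridFloor k (T ω) = t := fun ω hω => by
      have : ⌊((k : ℝ≥0) + 1) * T ω⌋₊ = m := hω
      simp only [gridFloor, this, ht]
    rw [setIntegral_congr_fun (f := fun ω => f (W (gridFloor k (T ω)) ω))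
        (g := fun ω => f (W t ω)) (hs k m)
        (fun ω hω => by simp only [e ω hω]),
      setIntegral_congr_fun (f := fun ω => g (gridFloor k (T ω)))
        (g := fun _ => g t) (hs k m) (fun ω hω => by simp only [e ω hω])]
    rw [← integral_indicator (hs k m), ← integral_indicator (hs k m)]
    have hA : MeasurableSet {u : ℝ≥0 | ⌊((k : ℝ≥0) + 1) * u⌋₊ = m} :=
      (Nat.measurable_floor.comp (measurable_const_mul _)) (measurableSet_singleton m)
    have h1 : IndepFun (fun ω => (s k m).indicator (fun _ => (1 : ℝ)) ω) (fun ω => f (W t ω)) P :=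
      hind.comp (φ := {u : ℝ≥0 | ⌊((k : ℝ≥0) + 1) * u⌋₊ = m}.indicator fun _ => (1 : ℝ))
        (ψ := fun w : ℝ≥0 → ℝ => f (w t)) (measurable_const.indicator hA)
        (f.continuous.measurable.comp (measurable_pi_apply t))
    have h2 := h1.integral_fun_mul_eq_mul_integral
      (measurable_const.indicator (hs k m)).aestronglyMeasurable
      (f.continuous.measurable.comp_aemeasurable (hW.aemeasurable t)).aestronglyMeasurable
    rw [hgW t, ← integral_mul_const] at h2
    refine Eq.trans (integral_congr_ae (.of_forall fun ω => ?_))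
      (h2.trans (integral_congr_ae (.of_forall fun ω => ?_)))
    · by_cases h : ω ∈ s k m <;> simp [h]
    · by_cases h : ω ∈ s k m <;> simp [h]
  have l1 : Tendsto (fun k => ∫ ω, f (W (gridFloor k (T ω)) ω) ∂P) atTop (𝓝 (∫ ω, f (W (T ω) ω) ∂P)) := by
    refine tendsto_integral_of_dominated_convergence (fun _ => ‖f‖)
      (fun k => (hfb k).aestronglyMeasurable) (integrable_const _)
      (fun k => .of_forall fun ω => f.norm_coe_le_norm _) ?_
    filter_upwards [hlim] with ω hω
    exact (f.continuous.tendsto _).comp hω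
  have l2 : Tendsto (fun k => ∫ ω, g (gridFloor k (T ω)) ∂P) atTop (𝓝 (∫ ω, g (T ω) ∂P)) := by
    refine tendsto_integral_of_dominated_convergence (fun _ => ‖f‖)
      (fun k => (hgi k).aestronglyMeasurable) (integrable_const _)
      (fun k => .of_forall fun ω => hgb _) (.of_forall fun ω => ?_)
    exact (hgc.tendsto _).comp ((NNReal.tendsto_coe.2 (hφ (T ω))))
  have key : ∫ ω, f (W (T ω) ω) ∂P = ∫ ω, g (T ω) ∂P :=
    tendsto_nhds_unique l1 (by simpa only [hk] using l2)
  rw [integral_map hWT f.continuous.aestronglyMeasurable, key, stoppedLaw,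
    integral_map hmul.aemeasurable f.continuous.aestronglyMeasurable,
    integral_prod]
  · rw [← hlaw, integral_map hTr.aemeasurable hgc.aestronglyMeasurable]
  · exact Integrable.of_bound (f.continuous.measurable.comp hmul).aestronglyMeasurable
      ‖f‖ (.of_forall fun ω => f.norm_coe_le_norm _)

end SkorohodLowerBound

end

open MeasureTheory ProbabilityTheory Filter Set
open scoped ENNReal NNReal Topology

noncomputable section

namespace SkorohodLowerBound

/-! The argument is Le Cam's two-point method. The base density is the law of `exp Y / S`, with `Y`
normal and `S` an independent Gamma variable of integer shape `k`. The rival multiplies it by `1 + δ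
cos (V log t)` and renormalises.

Observing `W_T` nearly erases the oscillation. Given `Y = y`, the time density times the normal
density at an observation `x` is proportional to `t ^ (-(k + 1/2) - 1) * exp (-(exp y + x ^ 2 / 2) /
t)`, again an inverse Gamma profile, now of shape `k + 1/2`. Averaging `cos (V log t)` against it
gains the factor `|Γ(k + 1/2 + iV)| / Γ(k + 1/2) = O(V ^ k e^{-πV/2})`, whatever `x` and `y` are.
Hence the two laws of `W_T` agree up to a relative error `η` of order `δ V ^ k e^{-πV/2}`
(`stoppedLaw_perturbed_mixDensity`), and samples with `n η ^ 2 ≤ 1` do not separate them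
(`le_minimaxRisk`). At `x = 1` the cosine is one for every `V`, so the two values differ there by at
least a multiple of `δ`.

The class restricts `δ`: modulation shifts the Mellin transform by `± iV`, so `δ` has to offset the
growth of the weight, `e^{βV}` or `V ^ β` (`lintegral_perturbed_mixDensity_lt`). The normal factor
makes the transform decay like a Gaussian, and a large log-variance brings the weighted integral
below any `L` (`exists_variance`). For `classC`, `V = log n / (π + 2β)` gives `e^{-βV} e^{-πV/2} =
n^{-1/2}` and the rate `e^{-βV} = n^{-β/(π+2β)}` up to logarithms; for `classD`, `V = log n` gives
`V^{-β}`. -/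

/-! ### Change of measure and the two-point reduction -/

/-- On a rectangle both the indicator and the density split over the coordinates, which are
independent under the product measure. -/
theorem pi_withDensity {Ω : Type*} [MeasurableSpace Ω] (μ : Measure Ω) [IsProbabilityMeasure μ]
    {g : Ω → ℝ≥0∞} (hg : Measurable g) [IsProbabilityMeasure (μ.withDensity g)] (n : ℕ) :
    Measure.pi (fun _ : Fin n => μ.withDensity g)
      = (Measure.pi fun _ : Fin n => μ).withDensity fun s => ∏ i, g (s i) := by
  refine (Measure.pi_eq (μ := fun _ : Fin n => μ.withDensity g) fun s hs => ?_)
  rw [withDensity_apply _ (MeasurableSet.univ_pi hs), ← lintegral_indicator (MeasurableSet.univ_pi hs)]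
  have h1 : (fun x : Fin n → Ω => (univ.pi s).indicator (fun s => ∏ i, g (s i)) x)
      = fun x => ∏ i, (s i).indicator g (x i) := by
    funext x
    by_cases hx : x ∈ univ.pi s
    · rw [indicator_of_mem hx]
      exact Finset.prod_congr rfl fun i _ => (indicator_of_mem (hx i (mem_univ i)) g).symm
    · rw [indicator_of_notMem hx]
      obtain ⟨i, hi⟩ : ∃ i, x i ∉ s i := by simpa using hx
      exact (Finset.prod_eq_zero (Finset.mem_univ i) (indicator_of_notMem hi g)).symm
  rw [h1]
  have hm : ∀ i, Measurable ((s i).indicator g) := fun i => hg.indicator (hs i)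
  have hind : iIndepFun (fun i (x : Fin n → Ω) => (s i).indicator g (x i))
      (Measure.pi fun _ : Fin n => μ) :=
    iIndepFun_pi (X := fun i => (s i).indicator g) fun i => (hm i).aemeasurable
  rw [lintegral_prod_eq_prod_lintegral_of_indepFun _ _ hind
    fun i => (hm i).comp (measurable_pi_apply i)]
  refine Finset.prod_congr rfl fun i _ => ?_
  rw [withDensity_apply _ (hs i), ← lintegral_indicator (hs i)]
  exact (measurePreserving_eval (fun _ : Fin n => μ) i).lintegral_comp (hm i)

theorem lintegral_pi_prod {Ω : Type*} [MeasurableSpace Ω] (μ : Measure Ω) [IsProbabilityMeasure μ]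
    {g : Ω → ℝ≥0∞} (hg : Measurable g) (n : ℕ) :
    ∫⁻ s, ∏ i, g (s i) ∂(Measure.pi fun _ : Fin n => μ) = (∫⁻ x, g x ∂μ) ^ n := by
  have hind : iIndepFun (fun i (x : Fin n → Ω) => g (x i)) (Measure.pi fun _ : Fin n => μ) :=
    iIndepFun_pi (X := fun _ => g) fun i => hg.aemeasurable
  rw [lintegral_prod_eq_prod_lintegral_of_indepFun _ _ hind
    fun i => hg.comp (measurable_pi_apply i)]
  rw [Finset.prod_congr rfl fun i _ =>
    (measurePreserving_eval (fun _ : Fin n => μ) i).lintegral_comp hg]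
  simp

/-- Change of measure when the second moment of the likelihood ratio is at most `3`. -/
theorem withDensity_apply_le_of_lintegral_sq {Ω : Type*} [MeasurableSpace Ω] (μ : Measure Ω)
    {l : Ω → ℝ≥0∞} (hl : Measurable l) (h : ∫⁻ x, l x ^ 2 ∂μ ≤ 3) {A : Set Ω}
    (hA : MeasurableSet A) : μ.withDensity l A ≤ 3 / 8 + 2 * μ A := by
  -- This is `(a - 4) ^ 2 ≥ 0`. The weights `1/8` and `2` are small enough for the total in
  -- `le_minimaxRisk` to stay below one.
  have key : ∀ a : ℝ≥0∞, a ≤ 8⁻¹ * a ^ 2 + 2 := by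
    intro a
    induction a with
    | top => simp
    | coe a =>
      have : (a : ℝ) ≤ 8⁻¹ * (a : ℝ) ^ 2 + 2 := by nlinarith [sq_nonneg ((a : ℝ) - 4)]
      have h' : a ≤ 8⁻¹ * a ^ 2 + 2 := by exact_mod_cast this
      have h8 : ((8 : ℝ≥0∞))⁻¹ = ((8⁻¹ : ℝ≥0) : ℝ≥0∞) := by
        rw [ENNReal.coe_inv (by norm_num)]; rfl
      rw [h8]
      exact_mod_cast h'
  rw [withDensity_apply _ hA]
  calc ∫⁻ x in A, l x ∂μ ≤ ∫⁻ x in A, (8⁻¹ * l x ^ 2 + 2) ∂μ := lintegral_mono fun x => key _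
    _ = 8⁻¹ * ∫⁻ x in A, l x ^ 2 ∂μ + 2 * μ A := by
      rw [lintegral_add_right _ measurable_const, lintegral_const_mul _ (hl.pow_const 2)]
      simp
    _ ≤ 8⁻¹ * 3 + 2 * μ A := by
      gcongr
      exact (setLIntegral_le_lintegral _ _).trans h
    _ = _ := by rw [ENNReal.div_eq_inv_mul]

/-- If two probability measures are within a factor `1 ± η` of each other, then their density has
second moment at most `1 + η ^ 2`. -/
theorem exists_density_of_le {Ω : Type*} [MeasurableSpace Ω] {μ ν : Measure Ω}
    [IsProbabilityMeasure μ] [IsProbabilityMeasure ν] {η : ℝ} (h0 : 0 ≤ η) (h1 : η ≤ 1)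
    (hle : ∀ B, MeasurableSet B → ν B ≤ ENNReal.ofReal (1 + η) * μ B)
    (hge : ∀ B, MeasurableSet B → ENNReal.ofReal (1 - η) * μ B ≤ ν B) :
    ∃ g : Ω → ℝ≥0∞, Measurable g ∧ ν = μ.withDensity g ∧
      ∫⁻ x, g x ^ 2 ∂μ ≤ ENNReal.ofReal (1 + η ^ 2) := by
  have hac : ν ≪ μ := by
    refine Measure.AbsolutelyContinuous.mk fun s hs h => ?_
    simpa [h] using hle s hs
  have hw : μ.withDensity (ν.rnDeriv μ) = ν := Measure.withDensity_rnDeriv_eq _ _ hac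
  have hm := Measure.measurable_rnDeriv ν μ
  refine ⟨ν.rnDeriv μ, hm, hw.symm, ?_⟩
  have hu : ∀ᵐ x ∂μ, ν.rnDeriv μ x ≤ ENNReal.ofReal (1 + η) := by
    refine ae_le_of_forall_setLIntegral_le_of_sigmaFinite hm fun s hs _ => ?_
    rw [← withDensity_apply _ hs, hw]
    simpa using hle s hs
  have hl : ∀ᵐ x ∂μ, ENNReal.ofReal (1 - η) ≤ ν.rnDeriv μ x := by
    refine ae_le_of_forall_setLIntegral_le_of_sigmaFinite measurable_const fun s hs _ => ?_
    rw [← withDensity_apply (ν.rnDeriv μ) hs, hw]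
    simpa using hge s hs
  have hint : ∫⁻ x, ν.rnDeriv μ x ∂μ = 1 := by
    rw [← setLIntegral_univ, ← withDensity_apply _ MeasurableSet.univ, hw, measure_univ]
  -- `(g - 1) ^ 2 ≤ η ^ 2`, rearranged to avoid truncated subtraction; integrating it with `∫ g = 1`
  -- bounds the second moment.
  have hp : ∀ᵐ x ∂μ, ν.rnDeriv μ x ^ 2 + 1 ≤ ENNReal.ofReal (η ^ 2) + 2 * ν.rnDeriv μ x := by
    filter_upwards [hu, hl] with x hxu hxl
    have hne : ν.rnDeriv μ x ≠ ∞ := (hxu.trans_lt ENNReal.ofReal_lt_top).ne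
    obtain ⟨a, ha⟩ : ∃ a : ℝ, 0 ≤ a ∧ ν.rnDeriv μ x = ENNReal.ofReal a :=
      ⟨_, ENNReal.toReal_nonneg, (ENNReal.ofReal_toReal hne).symm⟩
    rw [ha.2] at hxu hxl ⊢
    rw [ENNReal.ofReal_le_ofReal_iff (by linarith)] at hxu
    rw [ENNReal.ofReal_le_ofReal_iff ha.1] at hxl
    have h2 : (2 : ℝ≥0∞) = ENNReal.ofReal 2 := by simp
    rw [← ENNReal.ofReal_pow ha.1, ← ENNReal.ofReal_one, h2, ← ENNReal.ofReal_mul (by norm_num),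
      ← ENNReal.ofReal_add (by positivity) (by norm_num),
      ← ENNReal.ofReal_add (by positivity) (by nlinarith [ha.1])]
    refine ENNReal.ofReal_le_ofReal ?_
    nlinarith
  have h3 := lintegral_mono_ae hp
  rw [lintegral_add_right _ measurable_const, lintegral_add_left measurable_const,
    lintegral_const_mul _ hm, hint] at h3
  simp only [lintegral_const, measure_univ, mul_one] at h3
  rw [add_comm (1 : ℝ), ENNReal.ofReal_add (by positivity) (by norm_num), ENNReal.ofReal_one]
  refine (ENNReal.add_le_add_iff_right ENNReal.one_ne_top).1 (h3.trans_eq ?_)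
  rw [add_assoc, one_add_one_eq_two]

/-- Two hypotheses whose stopped laws agree up to a factor `1 ± η`, with `n * η ^ 2 ≤ 1`, and whose
values at `x` differ by at least `2 * r` force a minimax risk of at least `1 / 8`. -/
theorem le_minimaxRisk {G : Set (ℝ → ℝ)} {x r η : ℝ} {n : ℕ} {p q : ℝ → ℝ} (hp : p ∈ G) (hq : q ∈ G)
    [IsProbabilityMeasure (stoppedLaw p)] [IsProbabilityMeasure (stoppedLaw q)]
    (h0 : 0 ≤ η) (h1 : η ≤ 1) (hn : n * η ^ 2 ≤ 1) (hsep : 2 * r ≤ |q x - p x|)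
    (hle : ∀ B, MeasurableSet B → stoppedLaw q B ≤ ENNReal.ofReal (1 + η) * stoppedLaw p B)
    (hge : ∀ B, MeasurableSet B → ENNReal.ofReal (1 - η) * stoppedLaw p B ≤ stoppedLaw q B) :
    1 / 8 ≤ minimaxRisk G x n r := by
  obtain ⟨g, hg, hqg, hg2⟩ := exists_density_of_le h0 h1 hle hge
  refine le_iInf₂ fun est hest => ?_
  by_contra! hlt
  have hev : Measurable fun s => est s x := (measurable_pi_apply x).comp hest
  have hmeas : ∀ f : ℝ → ℝ, MeasurableSet {s : Fin n → ℝ | r ≤ |f x - est s x|} := fun f =>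
    measurableSet_le measurable_const (continuous_abs.measurable.comp (hev.const_sub _))
  have hP : sampleLaw n p {s | r ≤ |p x - est s x|} ≤ 1 / 8 :=
    (le_iSup₂ (f := fun f (_ : f ∈ G) => sampleLaw n f {s | r ≤ |f x - est s x|}) p hp).trans hlt.le
  have hQ : sampleLaw n q {s | r ≤ |q x - est s x|} ≤ 1 / 8 :=
    (le_iSup₂ (f := fun f (_ : f ∈ G) => sampleLaw n f {s | r ≤ |f x - est s x|}) q hq).trans hlt.le
  have : IsProbabilityMeasure ((stoppedLaw p).withDensity g) := hqg ▸ inferInstance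
  have hsq : sampleLaw n q = (sampleLaw n p).withDensity fun s => ∏ i, g (s i) := by
    rw [sampleLaw, sampleLaw, hqg, pi_withDensity _ hg]
  have hmom : ∫⁻ s, (∏ i, g (s i)) ^ 2 ∂(sampleLaw n p) ≤ 3 := by
    simp_rw [← Finset.prod_pow]
    rw [sampleLaw, lintegral_pi_prod (stoppedLaw p) (g := fun x => g x ^ 2) (hg.pow_const 2)]
    calc (∫⁻ x, g x ^ 2 ∂stoppedLaw p) ^ n ≤ ENNReal.ofReal (1 + η ^ 2) ^ n := by gcongr
      _ = ENNReal.ofReal ((1 + η ^ 2) ^ n) := (ENNReal.ofReal_pow (by positivity) n).symm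
      _ ≤ ENNReal.ofReal 3 := by
        refine ENNReal.ofReal_le_ofReal ?_
        calc (1 + η ^ 2) ^ n ≤ Real.exp (η ^ 2) ^ n := by
              gcongr; linarith [Real.add_one_le_exp (η ^ 2)]
          _ = Real.exp (n * η ^ 2) := by rw [← Real.exp_nat_mul]
          _ ≤ Real.exp 1 := Real.exp_le_exp.2 hn
          _ ≤ 3 := by linarith [Real.exp_one_lt_d9]
      _ = 3 := by simp
  have hA := withDensity_apply_le_of_lintegral_sq (sampleLaw n p) (l := fun s => ∏ i, g (s i))
    (Finset.measurable_prod _ fun i _ => hg.comp (measurable_pi_apply i)) hmom (hmeas p)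
  rw [← hsq] at hA
  -- By the triangle inequality an estimate cannot be closer than `r` to both values.
  have hcover : (univ : Set (Fin n → ℝ)) ⊆
      {s | r ≤ |p x - est s x|} ∪ {s | r ≤ |q x - est s x|} := by
    intro s _
    by_contra hcon
    simp only [mem_union, mem_ofPred_eq, not_or, not_le] at hcon
    have := abs_sub_le (q x) (est s x) (p x)
    rw [abs_sub_comm (est s x) (p x)] at this
    linarith [hcon.1, hcon.2]
  -- If both error probabilities were at most `1/8`, the two events covering the space would have
  -- total probability at most `3/4` under `q`.
  have hone : (1 : ℝ≥0∞) ≤ 3 / 8 + 2 * (1 / 8) + 1 / 8 := by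
    have hpr : IsProbabilityMeasure (sampleLaw n q) := by unfold sampleLaw; infer_instance
    calc (1 : ℝ≥0∞) = sampleLaw n q univ := (measure_univ).symm
      _ ≤ _ := (measure_mono hcover).trans (measure_union_le _ _)
      _ ≤ _ := by gcongr; exact hA.trans (by gcongr)
  have : (3 / 8 + 2 * (1 / 8) + 1 / 8 : ℝ≥0∞) = ENNReal.ofReal (3 / 4) := by
    have e8 : (8 : ℝ≥0∞) = ENNReal.ofReal 8 := by simp
    have e3 : (3 : ℝ≥0∞) = ENNReal.ofReal 3 := by simp
    have e2 : (2 : ℝ≥0∞) = ENNReal.ofReal 2 := by simp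
    rw [e8, e3, e2, ← ENNReal.ofReal_one, ← ENNReal.ofReal_div_of_pos (by norm_num),
      ← ENNReal.ofReal_div_of_pos (by norm_num), ← ENNReal.ofReal_mul (by norm_num),
      ← ENNReal.ofReal_add (by norm_num) (by norm_num),
      ← ENNReal.ofReal_add (by norm_num) (by norm_num)]
    norm_num
  rw [this, ← ENNReal.ofReal_one, ENNReal.ofReal_le_ofReal_iff (by norm_num)] at hone
  norm_num at hone

/-! ### Decay of the Gamma function on vertical lines -/

/-- On the line `Re z = 1/2` the point `1 - z` is the conjugate of `z`, so the reflection formula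
reads `|Γ(z)| ^ 2 = π / cosh (πV)`. -/
theorem norm_Gamma_half_add_le (V : ℝ) :
    ‖Complex.Gamma (1 / 2 + V * Complex.I)‖ ≤ √(2 * Real.pi) * Real.exp (-(Real.pi * V / 2)) := by
  set z : ℂ := 1 / 2 + V * Complex.I with hz
  have hconj : 1 - z = (starRingEnd ℂ) z := by
    apply Complex.ext <;> simp [hz]
    norm_num
  have h1 := Complex.Gamma_mul_Gamma_one_sub z
  have hsin : Complex.sin (Real.pi * z) = ((Real.cosh (Real.pi * V) : ℝ) : ℂ) := by
    rw [hz, mul_add, Complex.ofReal_cosh, ← Complex.cos_mul_I]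
    rw [show (Real.pi : ℂ) * (1 / 2) + Real.pi * (V * Complex.I)
      = (Real.pi * V : ℝ) * Complex.I + Real.pi / 2 by push_cast; ring, Complex.sin_add_pi_div_two]
  rw [hconj, Complex.Gamma_conj, hsin, Complex.mul_conj, ← Complex.ofReal_div] at h1
  have h2 : ‖Complex.Gamma z‖ ^ 2 = Real.pi / Real.cosh (Real.pi * V) := by
    rw [← Complex.normSq_eq_norm_sq]; exact_mod_cast h1
  have hcosh : Real.exp (Real.pi * V) / 2 ≤ Real.cosh (Real.pi * V) := by
    rw [Real.cosh_eq]; linarith [Real.exp_pos (-(Real.pi * V))]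
  refine le_of_sq_le_sq ?_ (by positivity)
  rw [h2, mul_pow, Real.sq_sqrt (by positivity), ← Real.exp_nat_mul]
  calc Real.pi / Real.cosh (Real.pi * V) ≤ Real.pi / (Real.exp (Real.pi * V) / 2) := by gcongr
    _ = 2 * Real.pi * (Real.exp (Real.pi * V))⁻¹ := by field_simp
    _ = _ := by rw [← Real.exp_neg]; congr 2; push_cast; ring

/-- The ratio `|Γ(a + 1/2 + i V)| / Γ(a + 1/2)`. -/
def gammaRatio (a V : ℝ) : ℝ :=
  ‖Complex.Gamma ((a + 1 / 2 : ℝ) + V * Complex.I)‖ / Real.Gamma (a + 1 / 2)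

/-- Starting from `Re z = 1/2`, the recurrence `Γ(z + 1) = z Γ(z)` is applied `k` times, each factor
`|z|` being at most a multiple of `V`. An integer `k` makes Stirling's formula unnecessary. -/
theorem exists_gammaRatio_le (k : ℕ) :
    ∃ C > 0, ∀ V : ℝ, 1 ≤ V → gammaRatio k V ≤ C * V ^ k * Real.exp (-(Real.pi * V / 2)) := by
  have key : ∃ C > 0, ∀ V : ℝ, 1 ≤ V →
      ‖Complex.Gamma (((k : ℝ) + 1 / 2 : ℝ) + V * Complex.I)‖
        ≤ C * V ^ k * Real.exp (-(Real.pi * V / 2)) := by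
    induction k with
    | zero =>
      refine ⟨√(2 * Real.pi), by positivity, fun V _ => ?_⟩
      simpa using norm_Gamma_half_add_le V
    | succ k ih =>
      obtain ⟨C, hC, h⟩ := ih
      refine ⟨(k + 2) * C, by positivity, fun V hV => ?_⟩
      set z : ℂ := ((k : ℝ) + 1 / 2 : ℝ) + V * Complex.I with hz
      have hre : z.re = (k : ℝ) + 1 / 2 := by simp [hz]
      have hz0 : z ≠ 0 := fun h0 => by
        rw [h0, Complex.zero_re] at hre
        have : (0 : ℝ) ≤ k := k.cast_nonneg
        linarith
      have hs : ((((k + 1 : ℕ) : ℝ) + 1 / 2 : ℝ) : ℂ) + V * Complex.I = z + 1 := by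
        rw [hz]; push_cast; ring
      have hnz : ‖z‖ ≤ (k + 2) * V := by
        calc ‖z‖ ≤ ‖(((k : ℝ) + 1 / 2 : ℝ) : ℂ)‖ + ‖(V : ℂ) * Complex.I‖ := norm_add_le _ _
          _ = (k + 1 / 2) + V := by
            rw [norm_mul, Complex.norm_I, Complex.norm_real, Complex.norm_real, mul_one,
              Real.norm_of_nonneg (by positivity), Real.norm_of_nonneg (by linarith)]
          _ ≤ _ := by nlinarith [(k.cast_nonneg : (0 : ℝ) ≤ k)]
      rw [hs, Complex.Gamma_add_one _ hz0, norm_mul]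
      calc ‖z‖ * ‖Complex.Gamma z‖
          ≤ ((k + 2) * V) * (C * V ^ k * Real.exp (-(Real.pi * V / 2))) := by
            gcongr; exact h V hV
        _ = _ := by ring
  obtain ⟨C, hC, h⟩ := key
  have hG : 0 < Real.Gamma ((k : ℝ) + 1 / 2) := Real.Gamma_pos_of_pos (by positivity)
  refine ⟨C / Real.Gamma ((k : ℝ) + 1 / 2), by positivity, fun V hV => ?_⟩
  rw [gammaRatio, div_le_iff₀ hG]
  refine (h V hV).trans_eq ?_
  field_simp

theorem norm_Gamma_le_of_re_pos {z : ℂ} (hz : 0 < z.re) : ‖Complex.Gamma z‖ ≤ Real.Gamma z.re := by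
  rw [Complex.Gamma_eq_integral hz, Real.Gamma_eq_integral hz]
  refine (norm_integral_le_integral_norm _).trans_eq
    (setIntegral_congr_fun measurableSet_Ioi fun t ht => ?_)
  simp only [norm_mul, Complex.norm_real, Real.norm_eq_abs, Real.abs_exp]
  rw [Complex.norm_cpow_eq_rpow_re_of_pos ht]
  simp

/-! ### Inverse Gamma densities -/

/-- The Mellin transform of `t ↦ exp (-c / t)`. -/
theorem hasMellin_exp_neg_div {c : ℝ} (hc : 0 < c) {s : ℂ} (hs : 0 < s.re) :
    HasMellin (fun t : ℝ => (Real.exp (-(c / t)) : ℂ)) (-s) (Complex.Gamma s * (c : ℂ) ^ (-s)) := by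
  have h1 : MellinConvergent (fun t : ℝ => (Real.exp (-t) : ℂ)) s := by
    have := Complex.GammaIntegral_convergent hs
    refine this.congr_fun (fun t _ => ?_) measurableSet_Ioi
    simp [mul_comm]
  have h2 : MellinConvergent (fun t : ℝ => (Real.exp (-(c * t)) : ℂ)) s :=
    (MellinConvergent.comp_mul_left (f := fun t : ℝ => (Real.exp (-t) : ℂ)) hc).2 h1
  -- The inversion `t ↦ t⁻¹` followed by a dilation reduces the transform to Euler's integral.
  have h3 := MellinConvergent.comp_rpow (f := fun t : ℝ => (Real.exp (-(c * t)) : ℂ)) (s := -s)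
    (a := -1) (by norm_num)
  have e : (fun t : ℝ => (Real.exp (-(c / t)) : ℂ))
      = fun t : ℝ => (fun u : ℝ => (Real.exp (-(c * u)) : ℂ)) (t ^ (-1 : ℝ)) := by
    funext t; simp [Real.rpow_neg_one, div_eq_mul_inv]
  refine ⟨?_, ?_⟩
  · rw [e, h3]
    simpa using! h2
  · rw [e, mellin_comp_rpow (fun u : ℝ => (Real.exp (-(c * u)) : ℂ))]
    have h4 := mellin_comp_mul_left (fun t : ℝ => (Real.exp (-t) : ℂ)) s hc
    rw [← Complex.GammaIntegral_eq_mellin, ← Complex.Gamma_eq_integral hs] at h4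
    have h5 : -s / ((-1 : ℝ) : ℂ) = s := by simp
    rw [h5, h4]
    simp [mul_comm]

/-- An oscillating factor `cos (V log t)` damps the integral of `t ^ (-b-1) exp (-c / t)` at least by
the factor `|Γ(b + iV)| / Γ(b)`. -/
theorem abs_integral_cos_le {c b : ℝ} (hc : 0 < c) (hb : 0 < b) (V : ℝ) :
    IntegrableOn (fun t : ℝ => t ^ (-(b + 1)) * Real.exp (-(c / t))) (Ioi 0) ∧
    |∫ t in Ioi (0 : ℝ), t ^ (-(b + 1)) * Real.exp (-(c / t)) * Real.cos (V * Real.log t)|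
      ≤ ‖Complex.Gamma (b + V * Complex.I)‖ / Real.Gamma b *
        ∫ t in Ioi (0 : ℝ), t ^ (-(b + 1)) * Real.exp (-(c / t)) := by
  have hG : 0 < Real.Gamma b := Real.Gamma_pos_of_pos hb
  have hre : (b + V * Complex.I : ℂ).re = b := by simp
  obtain ⟨i0, m0⟩ := hasMellin_exp_neg_div hc (s := (b : ℂ)) (by simpa using hb)
  obtain ⟨i1, m1⟩ := hasMellin_exp_neg_div hc (s := b + V * Complex.I) (by rw [hre]; exact hb)
  have e0 : ∀ t ∈ Ioi (0 : ℝ), (t : ℂ) ^ (-(b : ℂ) - 1) • (Real.exp (-(c / t)) : ℂ)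
      = ((t ^ (-(b + 1)) * Real.exp (-(c / t)) : ℝ) : ℂ) := fun t ht => by
    rw [Complex.ofReal_mul, Complex.ofReal_cpow (le_of_lt ht), smul_eq_mul]
    congr 2
    push_cast; ring
  have e1 : ∀ t ∈ Ioi (0 : ℝ),
      ((t : ℂ) ^ (-(b + V * Complex.I : ℂ) - 1) • (Real.exp (-(c / t)) : ℂ)).re
      = t ^ (-(b + 1)) * Real.exp (-(c / t)) * Real.cos (V * Real.log t) := fun t ht => by
    have ht0 : (t : ℂ) ≠ 0 := Complex.ofReal_ne_zero.2 (ne_of_gt ht)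
    have : (-(b + V * Complex.I : ℂ) - 1) = (-(b : ℂ) - 1) + (-(V : ℂ) * Complex.I) := by ring
    rw [this, Complex.cpow_add _ _ ht0, mul_comm ((t : ℂ) ^ (-(b : ℂ) - 1)), mul_smul, e0 t ht,
      smul_eq_mul, Complex.re_mul_ofReal, Complex.cpow_def_of_ne_zero ht0,
      ← Complex.ofReal_log (le_of_lt ht)]
    have : (Real.log t : ℂ) * (-(V : ℂ) * Complex.I) = ((-(V * Real.log t) : ℝ) : ℂ) * Complex.I := by
      push_cast; ring
    rw [this, Complex.exp_ofReal_mul_I_re, Real.cos_neg]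
    ring
  rw [mellin, setIntegral_congr_fun measurableSet_Ioi e0, integral_complex_ofReal] at m0
  have hc0 : 0 < c ^ (-b) := Real.rpow_pos_of_pos hc _
  have m0' : ∫ t in Ioi (0 : ℝ), t ^ (-(b + 1)) * Real.exp (-(c / t)) = Real.Gamma b * c ^ (-b) := by
    have : Complex.Gamma b * (c : ℂ) ^ (-(b : ℂ)) = ((Real.Gamma b * c ^ (-b) : ℝ) : ℂ) := by
      rw [Complex.ofReal_mul, Complex.ofReal_cpow hc.le, Complex.Gamma_ofReal]; push_cast; rfl
    rw [this] at m0
    exact_mod_cast m0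
  refine ⟨?_, ?_⟩
  · exact (i0.congr_fun e0 measurableSet_Ioi).re
  · have h1 : ∫ t in Ioi (0 : ℝ), t ^ (-(b + 1)) * Real.exp (-(c / t)) * Real.cos (V * Real.log t)
        = (Complex.Gamma (b + V * Complex.I) * (c : ℂ) ^ (-(b + V * Complex.I : ℂ))).re := by
      rw [← m1, mellin, ← setIntegral_congr_fun measurableSet_Ioi e1]
      exact integral_re i1
    rw [h1, m0']
    -- `|c ^ (-(b + iV))| = c ^ (-b)`, so `c` cancels from the ratio. This makes the damping uniform
    -- in the observation.
    refine (Complex.abs_re_le_norm _).trans_eq ?_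
    rw [norm_mul, Complex.norm_cpow_eq_rpow_re_of_pos hc, Complex.neg_re, hre]
    field_simp

/-- The density at `t` of `exp y / S`, where `S` is Gamma distributed with shape `k`. -/
def igDensity (k : ℕ) (y t : ℝ) : ℝ :=
  Real.exp (k * y) * t ^ (-((k : ℝ) + 1)) * Real.exp (-(Real.exp y / t)) / Real.Gamma k

theorem igDensity_pos {k : ℕ} (hk : 0 < k) (y : ℝ) {t : ℝ} (ht : 0 < t) : 0 < igDensity k y t := by
  have : 0 < Real.Gamma k := Real.Gamma_pos_of_pos (by exact_mod_cast hk)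
  unfold igDensity
  positivity

theorem measurable_igDensity (k : ℕ) : Measurable fun q : ℝ × ℝ => igDensity k q.1 q.2 := by
  unfold igDensity
  fun_prop

/-- With `u = exp y / t` this is `u ^ k e^{-u} ≤ k!`. The bound is free of `y`, hence usable for
domination when `y` is averaged out. -/
theorem igDensity_le {k : ℕ} (hk : 0 < k) (y : ℝ) {t : ℝ} (ht : 0 < t) :
    igDensity k y t ≤ k.factorial / Real.Gamma k / t := by
  have hG : 0 < Real.Gamma k := Real.Gamma_pos_of_pos (by exact_mod_cast hk)
  have h1 := Real.pow_div_factorial_le_exp (Real.exp y / t) (div_pos (Real.exp_pos y) ht).le k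
  have h2 : Real.exp (k * y) * t ^ (-((k : ℝ) + 1)) = (Real.exp y / t) ^ k / t := by
    rw [Real.exp_nat_mul, div_pow, Real.rpow_neg ht.le, Real.rpow_add_one ht.ne', Real.rpow_natCast]
    field_simp
  rw [igDensity, h2]
  have h3 : (Real.exp y / t) ^ k * Real.exp (-(Real.exp y / t)) ≤ k.factorial := by
    rw [Real.exp_neg, ← div_eq_mul_inv, div_le_iff₀ (Real.exp_pos _), mul_comm]
    rwa [div_le_iff₀ (by positivity)] at h1
  rw [div_mul_eq_mul_div, div_right_comm]
  exact div_le_div_of_nonneg_right (div_le_div_of_nonneg_right h3 hG.le) ht.le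

/-- The integrand is that of `hasMellin_exp_neg_div` with `s = k + 1 - z`. The parameter `y`
survives only in `exp (y (z - 1))`, so mixing over a normal `y` will produce a moment generating
function. -/
theorem igDensity_hasMellin {k : ℕ} (y : ℝ) {z : ℂ} (hz : z.re < k + 1) :
    HasMellin (fun t => (igDensity k y t : ℂ)) z
      (Complex.Gamma (k + 1 - z) / Real.Gamma k * Complex.exp (y * (z - 1))) := by
  have hs : 0 < (k + 1 - z : ℂ).re := by simp; linarith
  have h1 := hasMellin_exp_neg_div (Real.exp_pos y) hs
  set f : ℝ → ℂ := fun t => (Real.exp (-(Real.exp y / t)) : ℂ)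
  set A : ℂ := Real.exp (k * y) / Real.Gamma k with hA
  have e : ∀ t ∈ Ioi (0 : ℝ), (t : ℂ) ^ (z - 1) • (igDensity k y t : ℂ)
      = A • ((t : ℂ) ^ (-(k + 1 - z : ℂ) - 1) • f t) := fun t ht => by
    have ht0 : (t : ℂ) ≠ 0 := Complex.ofReal_ne_zero.2 (ne_of_gt ht)
    have : (-(k + 1 - z : ℂ) - 1) = (z - 1) + (-((k : ℝ) + 1) : ℝ) := by push_cast; ring
    rw [this, Complex.cpow_add _ _ ht0, ← Complex.ofReal_cpow (le_of_lt ht), igDensity, hA]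
    simp only [smul_eq_mul, f]
    push_cast
    ring
  refine ⟨(IntegrableOn.congr_fun (h1.1.smul A) (fun t ht => (e t ht).symm) measurableSet_Ioi), ?_⟩
  rw [mellin, setIntegral_congr_fun measurableSet_Ioi e, integral_smul]
  have h2 := h1.2
  rw [mellin] at h2
  rw [h2, hA, smul_eq_mul, Complex.cpow_def_of_ne_zero
    (Complex.ofReal_ne_zero.2 (Real.exp_ne_zero _)), ← Complex.ofReal_log (Real.exp_pos y).le,
    Real.log_exp, Complex.ofReal_exp (k * y)]
  have : Complex.exp (y * (z - 1)) = Complex.exp ((k * y : ℝ)) * Complex.exp (y * -(k + 1 - z)) := by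
    rw [← Complex.exp_add]; congr 1; push_cast; ring
  rw [this]
  ring

theorem ofReal_rpow_mul_igDensity {k : ℕ} (y σ : ℝ) {t : ℝ} (ht : 0 < t) :
    (t : ℂ) ^ ((σ : ℂ) - 1) • (igDensity k y t : ℂ) = ((t ^ (σ - 1) * igDensity k y t : ℝ) : ℂ) := by
  rw [Complex.ofReal_mul, Complex.ofReal_cpow ht.le, smul_eq_mul]
  push_cast
  rfl

theorem integrableOn_rpow_mul_igDensity {k : ℕ} (y : ℝ) {σ : ℝ} (hσ : σ < k + 1) :
    IntegrableOn (fun t => t ^ (σ - 1) * igDensity k y t) (Ioi 0) := by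
  have h := (igDensity_hasMellin (k := k) y (z := (σ : ℂ)) (by simpa using hσ)).1
  exact (IntegrableOn.congr_fun h (fun t ht => ofReal_rpow_mul_igDensity y σ ht)
    measurableSet_Ioi).re

theorem integral_rpow_mul_igDensity {k : ℕ} (y : ℝ) {σ : ℝ} (hσ : σ < k + 1) :
    ∫ t in Ioi (0 : ℝ), t ^ (σ - 1) * igDensity k y t
      = Real.Gamma (k + 1 - σ) / Real.Gamma k * Real.exp ((σ - 1) * y) := by
  have h := (igDensity_hasMellin (k := k) y (z := (σ : ℂ)) (by simpa using hσ)).2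
  rw [mellin, setIntegral_congr_fun measurableSet_Ioi
    (fun t ht => ofReal_rpow_mul_igDensity y σ ht), integral_complex_ofReal] at h
  have e : Complex.Gamma (k + 1 - σ) / Real.Gamma k * Complex.exp (y * (σ - 1))
      = ((Real.Gamma (k + 1 - σ) / Real.Gamma k * Real.exp ((σ - 1) * y) : ℝ) : ℂ) := by
    push_cast [← Complex.Gamma_ofReal]
    rw [mul_comm (y : ℂ)]
  rw [e] at h
  exact_mod_cast h

/-! ### The log-normal mixture and its Mellin transform -/

/-- The density of the product of a log-normal variable and an independent inverse Gamma variable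
with shape `k`. -/
def mixDensity (k : ℕ) (m : ℝ) (v : ℝ≥0) (t : ℝ) : ℝ :=
  ∫ y, igDensity k y t ∂(gaussianReal m v)

section Mix

variable {k : ℕ} {m : ℝ} {v : ℝ≥0}

theorem integrable_igDensity (hk : 0 < k) {t : ℝ} (ht : 0 < t) :
    Integrable (fun y => igDensity k y t) (gaussianReal m v) := by
  refine Integrable.of_bound ((measurable_igDensity k).comp
    (measurable_id.prodMk measurable_const)).aestronglyMeasurable
    (k.factorial / Real.Gamma k / t) (.of_forall fun y => ?_)
  change ‖igDensity k y t‖ ≤ _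
  rw [Real.norm_of_nonneg (igDensity_pos hk y ht).le]
  exact igDensity_le hk y ht

theorem mixDensity_pos (hk : 0 < k) {t : ℝ} (ht : 0 < t) : 0 < mixDensity k m v t := by
  rw [mixDensity, integral_pos_iff_support_of_nonneg (fun y => (igDensity_pos hk y ht).le)
    (integrable_igDensity hk ht)]
  have : Function.support (fun y => igDensity k y t) = univ :=
    eq_univ_of_forall fun y => (igDensity_pos hk y ht).ne'
  rw [this, measure_univ]
  exact one_pos

theorem continuousOn_mixDensity (hk : 0 < k) : ContinuousOn (mixDensity k m v) (Ioi 0) := by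
  have hG : 0 < Real.Gamma k := Real.Gamma_pos_of_pos (by exact_mod_cast hk)
  intro t₀ ht₀
  have ht₀' : (0 : ℝ) < t₀ := ht₀
  refine ContinuousAt.continuousWithinAt ?_
  refine continuousAt_of_dominated (bound := fun _ => k.factorial / Real.Gamma k / (t₀ / 2))
    ?_ ?_ (integrable_const _) ?_
  · exact .of_forall fun t => ((measurable_igDensity k).comp
      (measurable_id.prodMk measurable_const)).aestronglyMeasurable
  · filter_upwards [lt_mem_nhds (half_lt_self ht₀')] with t ht
    refine .of_forall fun y => ?_
    have ht0 : 0 < t := (half_pos ht₀').trans ht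
    rw [Real.norm_of_nonneg (igDensity_pos hk y ht0).le]
    refine (igDensity_le hk y ht0).trans ?_
    gcongr
  · refine .of_forall fun y => ?_
    unfold igDensity
    have h1 : ContinuousAt (fun t : ℝ => t ^ (-((k : ℝ) + 1))) t₀ :=
      Real.continuousAt_rpow_const _ _ (Or.inl ht₀'.ne')
    have h2 : ContinuousAt (fun t : ℝ => Real.exp (-(Real.exp y / t))) t₀ :=
      (continuousAt_const.div continuousAt_id ht₀'.ne').neg.rexp
    exact ((continuousAt_const.mul h1).mul h2).div_const _

/-- The inner integral over `t` is a multiple of `exp ((σ - 1) y)`, and normal laws have all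
exponential moments. This licenses the exchanges of integrals over `y` and `t`. -/
theorem integrable_prod_igDensity (hk : 0 < k) {σ : ℝ} (hσ : σ < k + 1) :
    Integrable (fun q : ℝ × ℝ => q.2 ^ (σ - 1) * igDensity k q.1 q.2)
      ((gaussianReal m v).prod (volume.restrict (Ioi 0))) := by
  have hm : Measurable fun q : ℝ × ℝ => q.2 ^ (σ - 1) * igDensity k q.1 q.2 :=
    (measurable_snd.pow_const _).mul (measurable_igDensity k)
  rw [integrable_prod_iff hm.aestronglyMeasurable]
  refine ⟨.of_forall fun y => integrableOn_rpow_mul_igDensity y hσ, ?_⟩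
  have e : ∀ y : ℝ, ∫ t in Ioi (0 : ℝ), ‖t ^ (σ - 1) * igDensity k y t‖
      = Real.Gamma (k + 1 - σ) / Real.Gamma k * Real.exp ((σ - 1) * y) := fun y => by
    rw [← integral_rpow_mul_igDensity y hσ]
    refine setIntegral_congr_fun measurableSet_Ioi fun t ht => ?_
    have ht' : (0 : ℝ) < t := ht
    exact Real.norm_of_nonneg (mul_nonneg (by positivity) (igDensity_pos hk y ht').le)
  simp_rw [e]
  exact (integrable_exp_mul_gaussianReal (σ - 1)).const_mul _

theorem integrable_prod_igDensity_complex (hk : 0 < k) {z : ℂ} (hz : z.re < k + 1) :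
    Integrable (fun q : ℝ × ℝ => (q.2 : ℂ) ^ (z - 1) • (igDensity k q.1 q.2 : ℂ))
      ((gaussianReal m v).prod (volume.restrict (Ioi 0))) := by
  refine (integrable_prod_igDensity hk hz).mono' ?_ ?_
  · have h1 : Measurable fun q : ℝ × ℝ => (q.2 : ℂ) ^ (z - 1) :=
      (Complex.measurable_ofReal.comp measurable_snd).pow_const _
    exact (h1.mul (measurable_igDensity k).complex_ofReal).aestronglyMeasurable
  · have : ∀ᵐ q : ℝ × ℝ ∂((gaussianReal m v).prod (volume.restrict (Ioi 0))), q.2 ∈ Ioi (0 : ℝ) :=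
      Measure.quasiMeasurePreserving_snd.ae (ae_restrict_mem measurableSet_Ioi)
    filter_upwards [this] with q hq
    have hq' : 0 < q.2 := hq
    rw [norm_smul, Complex.norm_cpow_eq_rpow_re_of_pos hq', Complex.norm_real,
      Real.norm_of_nonneg (igDensity_pos hk _ hq').le]
    simp

/-- By Fubini the transform of `igDensity` is averaged over `y`, and the average of `exp (y (z -
1))` is the complex moment generating function of the normal law. -/
theorem hasMellin_mixDensity (hk : 0 < k) {z : ℂ} (hz : z.re < k + 1) :
    HasMellin (fun t => (mixDensity k m v t : ℂ)) z
      (Complex.Gamma (k + 1 - z) / Real.Gamma k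
        * Complex.exp ((z - 1) * m + v * (z - 1) ^ 2 / 2)) := by
  have hI := integrable_prod_igDensity_complex (m := m) (v := v) hk hz
  have e : ∀ t : ℝ, (t : ℂ) ^ (z - 1) • (mixDensity k m v t : ℂ)
      = ∫ y, (t : ℂ) ^ (z - 1) • (igDensity k y t : ℂ) ∂(gaussianReal m v) := fun t => by
    rw [integral_smul, integral_complex_ofReal]; rfl
  refine ⟨?_, ?_⟩
  · refine Integrable.congr hI.integral_prod_right (.of_forall fun t => ?_)
    exact (e t).symm
  · rw [mellin]
    simp_rw [e]
    rw [integral_integral_swap (μ := volume.restrict (Ioi 0)) (ν := gaussianReal m v)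
      (f := fun (t y : ℝ) => (t : ℂ) ^ (z - 1) • (igDensity k y t : ℂ)) hI.swap]
    rw [← complexMGF_id_gaussianReal, complexMGF, ← integral_const_mul]
    refine integral_congr_ae (.of_forall fun y => ?_)
    have := (igDensity_hasMellin (k := k) y hz).2
    rw [mellin] at this
    simp only [this, id, mul_comm (y : ℂ)]

theorem integrableOn_mixDensity (hk : 0 < k) : IntegrableOn (mixDensity k m v) (Ioi 0) := by
  have h := (integrable_prod_igDensity (m := m) (v := v) hk (σ := 1)
    (by simpa using hk)).integral_prod_right
  simpa [mixDensity] using! h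

theorem integral_mixDensity (hk : 0 < k) : ∫ t in Ioi (0 : ℝ), mixDensity k m v t = 1 := by
  have h := (hasMellin_mixDensity (m := m) (v := v) hk (z := 1) (by simpa using hk)).2
  have hG : (Real.Gamma k : ℂ) ≠ 0 :=
    Complex.ofReal_ne_zero.2 (Real.Gamma_pos_of_pos (by exact_mod_cast hk)).ne'
  have hG' : Complex.Gamma k = Real.Gamma k := by rw [← Complex.Gamma_ofReal]; simp
  simp only [mellin, sub_self, Complex.cpow_zero, one_smul, integral_complex_ofReal,
    add_sub_cancel_right, hG', div_self hG] at h
  simpa using! h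

/-- A Gaussian bound for the Mellin transform of `mixDensity`, with a log-mean for which the constant
does not depend on the log-variance. -/
theorem norm_mellinOf_mixDensity_le (hk : 0 < k) {γ : ℝ} (hγ : γ < k + 1) (w : ℝ) :
    ‖mellinOf (mixDensity k (-(v * (γ - 1))) v) (γ + w * Complex.I)‖
      ≤ Real.Gamma (k + 1 - γ) / Real.Gamma k * Real.exp (-(v * w ^ 2 / 2)) := by
  have hG : 0 < Real.Gamma k := Real.Gamma_pos_of_pos (by exact_mod_cast hk)
  have hre : (γ + w * Complex.I : ℂ).re = γ := by simp
  rw [mellinOf, (hasMellin_mixDensity hk (by rw [hre]; exact hγ)).2, norm_mul, norm_div,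
    Complex.norm_real, Real.norm_of_nonneg hG.le, Complex.norm_exp]
  have h1 : (k + 1 - (γ + w * Complex.I) : ℂ).re = k + 1 - γ := by simp
  have h2 := norm_Gamma_le_of_re_pos (z := k + 1 - (γ + w * Complex.I)) (by rw [h1]; linarith)
  rw [h1] at h2
  -- A centred `Y` would leave a factor `exp (v (γ - 1) ^ 2 / 2)` growing with `v`; the chosen
  -- log-mean flips its sign, and it can be dropped.
  have h3 : (((γ + w * Complex.I : ℂ) - 1) * ((-(v * (γ - 1)) : ℝ) : ℂ)
      + v * ((γ + w * Complex.I : ℂ) - 1) ^ 2 / 2).re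
      = -(v * w ^ 2 / 2) - v * (γ - 1) ^ 2 / 2 := by
    have : (((γ + w * Complex.I : ℂ) - 1) * ((-(v * (γ - 1)) : ℝ) : ℂ)
      + v * ((γ + w * Complex.I : ℂ) - 1) ^ 2 / 2)
      = ((-(v * w ^ 2 / 2) - v * (γ - 1) ^ 2 / 2 : ℝ) : ℂ)
        + ((-(v * (γ - 1)) * w + v * (γ - 1) * w : ℝ) : ℂ) * Complex.I := by
      push_cast
      linear_combination (v * w ^ 2 / 2 : ℂ) * Complex.I_sq
    rw [this, Complex.add_re, Complex.re_ofReal_mul, Complex.I_re, Complex.ofReal_re, mul_zero,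
      add_zero]
  rw [h3]
  gcongr
  have : 0 ≤ (v : ℝ) * (γ - 1) ^ 2 / 2 := by positivity
  linarith

end Mix

/-! ### The law of the stopped process -/

/-- The probability that a centred normal variable with variance `t` lies in `B`. -/
def normalProb (B : Set ℝ) (t : ℝ) : ℝ := (gaussianReal 0 t.toNNReal).real B

theorem normalProb_nonneg (B : Set ℝ) (t : ℝ) : 0 ≤ normalProb B t := measureReal_nonneg

theorem normalProb_le_one (B : Set ℝ) (t : ℝ) : normalProb B t ≤ 1 := measureReal_le_one

theorem measurable_normalProb {B : Set ℝ} (hB : MeasurableSet B) : Measurable (normalProb B) := by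
  have h : Measurable fun t : ℝ => gaussianReal 0 t.toNNReal :=
    measurable_gaussianReal.comp (measurable_const.prodMk measurable_real_toNNReal)
  exact ((Measure.measurable_coe hB).comp h).ennreal_toReal

theorem gaussianPDFReal_toNNReal {t : ℝ} (ht : 0 < t) (x : ℝ) :
    gaussianPDFReal 0 t.toNNReal x
      = (√(2 * Real.pi))⁻¹ * t ^ (-(1 / 2) : ℝ) * Real.exp (-(x ^ 2 / 2 / t)) := by
  rw [gaussianPDFReal, Real.coe_toNNReal _ ht.le, Real.sqrt_mul (by positivity), mul_inv,
    Real.rpow_neg ht.le, ← Real.sqrt_eq_rpow, sub_zero]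
  congr 2
  field_simp

theorem normalProb_eq_integral {t : ℝ} (ht : 0 < t) (B : Set ℝ) :
    normalProb B t = ∫ x in B, gaussianPDFReal 0 t.toNNReal x := by
  have h0 : t.toNNReal ≠ 0 := (Real.toNNReal_pos.2 ht).ne'
  rw [normalProb, measureReal_def, gaussianReal_apply_eq_integral _ h0,
    ENNReal.toReal_ofReal (integral_nonneg fun x => gaussianPDFReal_nonneg _ _ _)]

/-- Given `T = t`, the variable `√t Z` is centred normal with variance `t`; Tonelli then turns the
law into a real integral. -/
theorem stoppedLaw_apply {p : ℝ → ℝ} (hp : ∀ t ∈ Ioi (0 : ℝ), 0 ≤ p t)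
    (hi : IntegrableOn p (Ioi 0)) {B : Set ℝ} (hB : MeasurableSet B) :
    stoppedLaw p B = ENNReal.ofReal (∫ t in Ioi (0 : ℝ), p t * normalProb B t) := by
  have hmul : Measurable fun q : ℝ × ℝ => √q.1 * q.2 := by fun_prop
  have hgauss : ∀ t : ℝ, gaussianReal 0 1 (Prod.mk t ⁻¹' ((fun q : ℝ × ℝ => √q.1 * q.2) ⁻¹' B))
      = ENNReal.ofReal (normalProb B t) := fun t => by
    have h2 : (gaussianReal 0 1).map (fun z => √t * z) = gaussianReal 0 t.toNNReal := by
      rw [gaussianReal_map_const_mul]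
      congr 1
      · simp
      · ext; simp [Real.sq_sqrt', Real.coe_toNNReal']
    rw [normalProb, ofReal_measureReal, ← h2, Measure.map_apply (by fun_prop) hB]
    rfl
  have hsf : SFinite (timeLaw p) := by unfold timeLaw; infer_instance
  rw [stoppedLaw, Measure.map_apply hmul hB, Measure.prod_apply (hmul hB)]
  simp_rw [hgauss]
  rw [timeLaw, lintegral_withDensity_eq_lintegral_mul₀ hi.aestronglyMeasurable.aemeasurable.ennreal_ofReal
    (measurable_normalProb hB).ennreal_ofReal.aemeasurable, ofReal_integral_eq_lintegral_ofReal]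
  · refine setLIntegral_congr_fun measurableSet_Ioi fun t ht => ?_
    simp only [Pi.mul_apply]
    rw [← ENNReal.ofReal_mul (hp t ht)]
  · exact hi.mul_bdd (c := 1) (measurable_normalProb hB).aestronglyMeasurable
      (.of_forall fun t => by
        rw [Real.norm_of_nonneg (normalProb_nonneg B t)]; exact normalProb_le_one B t)
  · filter_upwards [ae_restrict_mem measurableSet_Ioi] with t ht
    exact mul_nonneg (hp t ht) (normalProb_nonneg B t)

theorem IsDensity.isProbabilityMeasure {p : ℝ → ℝ} (hp : IsDensity p) :
    IsProbabilityMeasure (stoppedLaw p) := by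
  have h : IsProbabilityMeasure (timeLaw p) := ⟨by
    rw [timeLaw, withDensity_apply _ MeasurableSet.univ, Measure.restrict_univ]
    exact hp.lintegral_eq_one⟩
  exact Measure.isProbabilityMeasure_map (by fun_prop)

/-! ### Damping of oscillations by the Gaussian kernel -/

section Oscillation

variable {k : ℕ} {m : ℝ} {v : ℝ≥0}

/-- Pointwise in the observation, oscillation of the time density is damped by `gammaRatio`. -/
theorem abs_integral_igDensity_gaussianPDFReal_cos_le (hk : 0 < k) (y x V : ℝ) :
    |∫ t in Ioi (0 : ℝ), igDensity k y t * Real.cos (V * Real.log t)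
        * gaussianPDFReal 0 t.toNNReal x|
      ≤ gammaRatio k V *
        ∫ t in Ioi (0 : ℝ), igDensity k y t * gaussianPDFReal 0 t.toNNReal x := by
  have hG : 0 < Real.Gamma k := Real.Gamma_pos_of_pos (by exact_mod_cast hk)
  have hc : 0 < Real.exp y + x ^ 2 / 2 := by positivity
  have hb : 0 < (k : ℝ) + 1 / 2 := by positivity
  set A : ℝ := Real.exp (k * y) / Real.Gamma k * (√(2 * Real.pi))⁻¹ with hA
  have hA0 : 0 ≤ A := by positivity
  -- The normal density in `t` adds `1/2` to the shape and `x ^ 2 / 2` to the scale, so the product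
  -- stays in the inverse Gamma family.
  have e : ∀ t ∈ Ioi (0 : ℝ), igDensity k y t * gaussianPDFReal 0 t.toNNReal x
      = A * (t ^ (-((k + 1 / 2 : ℝ) + 1)) * Real.exp (-((Real.exp y + x ^ 2 / 2) / t))) :=
      fun t ht => by
    have ht' : 0 < t := ht
    rw [gaussianPDFReal_toNNReal ht', igDensity, hA,
      show -((k + 1 / 2 : ℝ) + 1) = -((k : ℝ) + 1) + (-(1 / 2)) by ring, Real.rpow_add ht', add_div,
      neg_add (Real.exp y / t), Real.exp_add (-(Real.exp y / t))]
    ring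
  have e' : ∀ t ∈ Ioi (0 : ℝ), igDensity k y t * Real.cos (V * Real.log t)
        * gaussianPDFReal 0 t.toNNReal x
      = A * (t ^ (-((k + 1 / 2 : ℝ) + 1)) * Real.exp (-((Real.exp y + x ^ 2 / 2) / t))
        * Real.cos (V * Real.log t)) := fun t ht => by
    rw [mul_right_comm, e t ht]; ring
  rw [setIntegral_congr_fun measurableSet_Ioi e, setIntegral_congr_fun measurableSet_Ioi e',
    integral_const_mul, integral_const_mul, abs_mul, abs_of_nonneg hA0, mul_left_comm]
  exact mul_le_mul_of_nonneg_left (abs_integral_cos_le hc hb V).2 hA0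

theorem integrableOn_igDensity (hk : 0 < k) (y : ℝ) : IntegrableOn (igDensity k y) (Ioi 0) := by
  simpa using! integrableOn_rpow_mul_igDensity (k := k) y (σ := 1) (by simpa using hk)

theorem integrable_igDensity_mul_gaussianPDFReal (hk : 0 < k) (y : ℝ) :
    Integrable (fun q : ℝ × ℝ => igDensity k y q.1 * gaussianPDFReal 0 q.1.toNNReal q.2)
      ((volume.restrict (Ioi 0)).prod volume) := by
  have hm : Measurable fun q : ℝ × ℝ => igDensity k y q.1 * gaussianPDFReal 0 q.1.toNNReal q.2 := by
    refine ((measurable_igDensity k).comp (measurable_const.prodMk measurable_fst)).mul ?_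
    exact measurable_uncurry_gaussianPDFReal.comp (measurable_const.prodMk
      ((measurable_real_toNNReal.comp measurable_fst).prodMk measurable_snd))
  rw [integrable_prod_iff hm.aestronglyMeasurable]
  refine ⟨.of_forall fun t => (integrable_gaussianPDFReal 0 t.toNNReal).const_mul (igDensity k y t), ?_⟩
  refine (integrableOn_igDensity hk y).congr ?_
  filter_upwards [ae_restrict_mem measurableSet_Ioi] with t ht
  have ht' : 0 < t := ht
  have h0 : t.toNNReal ≠ 0 := (Real.toNNReal_pos.2 ht').ne'
  simp_rw [norm_mul, Real.norm_of_nonneg (gaussianPDFReal_nonneg _ _ _),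
    Real.norm_of_nonneg (igDensity_pos hk y ht').le]
  rw [integral_const_mul, integral_gaussianPDFReal_eq_one _ h0, mul_one]

/-- The damping factor does not depend on the observation, so the pointwise bound integrates over
`B`. -/
theorem abs_integral_igDensity_normalProb_cos_le (hk : 0 < k) (y V : ℝ) (B : Set ℝ) :
    |∫ t in Ioi (0 : ℝ), igDensity k y t * Real.cos (V * Real.log t) * normalProb B t|
      ≤ gammaRatio k V * ∫ t in Ioi (0 : ℝ), igDensity k y t * normalProb B t := by
  have hI : Integrable (fun q : ℝ × ℝ => igDensity k y q.1 * gaussianPDFReal 0 q.1.toNNReal q.2)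
      ((volume.restrict (Ioi 0)).prod (volume.restrict B)) :=
    (integrable_igDensity_mul_gaussianPDFReal hk y).mono_measure
      (Measure.prod_mono le_rfl Measure.restrict_le_self)
  have hcos : Measurable fun q : ℝ × ℝ => Real.cos (V * Real.log q.1) := by fun_prop
  have hI' : Integrable (fun q : ℝ × ℝ => igDensity k y q.1 * Real.cos (V * Real.log q.1)
      * gaussianPDFReal 0 q.1.toNNReal q.2) ((volume.restrict (Ioi 0)).prod (volume.restrict B)) := by
    refine (hI.mul_bdd (c := 1) hcos.aestronglyMeasurable
      (.of_forall fun q => Real.abs_cos_le_one _)).congr (.of_forall fun q => ?_)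
    exact mul_right_comm _ _ _
  have e1 : ∫ t in Ioi (0 : ℝ), igDensity k y t * normalProb B t
      = ∫ x in B, ∫ t in Ioi (0 : ℝ), igDensity k y t * gaussianPDFReal 0 t.toNNReal x := by
    rw [← integral_integral_swap (μ := volume.restrict (Ioi 0)) (ν := volume.restrict B)
      (f := fun (t x : ℝ) => igDensity k y t * gaussianPDFReal 0 t.toNNReal x) hI]
    refine setIntegral_congr_fun measurableSet_Ioi fun t ht => ?_
    rw [normalProb_eq_integral ht, integral_const_mul]
  have e2 : ∫ t in Ioi (0 : ℝ), igDensity k y t * Real.cos (V * Real.log t) * normalProb B t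
      = ∫ x in B, ∫ t in Ioi (0 : ℝ), igDensity k y t * Real.cos (V * Real.log t)
        * gaussianPDFReal 0 t.toNNReal x := by
    rw [← integral_integral_swap (μ := volume.restrict (Ioi 0)) (ν := volume.restrict B)
      (f := fun (t x : ℝ) => igDensity k y t * Real.cos (V * Real.log t)
        * gaussianPDFReal 0 t.toNNReal x) hI']
    refine setIntegral_congr_fun measurableSet_Ioi fun t ht => ?_
    rw [normalProb_eq_integral ht, integral_const_mul]
  rw [e1, e2, ← integral_const_mul]
  refine (abs_integral_le_integral_abs).trans (integral_mono hI'.integral_prod_right.abs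
    (hI.integral_prod_right.const_mul _) fun x => ?_)
  exact abs_integral_igDensity_gaussianPDFReal_cos_le hk y x V

theorem integral_mixDensity_mul (hk : 0 < k) {w : ℝ → ℝ} (hw : Measurable w)
    (hb : ∀ t, |w t| ≤ 1) :
    Integrable (fun y => ∫ t in Ioi (0 : ℝ), igDensity k y t * w t) (gaussianReal m v) ∧
    ∫ t in Ioi (0 : ℝ), mixDensity k m v t * w t
      = ∫ y, (∫ t in Ioi (0 : ℝ), igDensity k y t * w t) ∂(gaussianReal m v) := by
  have h := integrable_prod_igDensity (m := m) (v := v) hk (σ := 1) (by simpa using hk)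
  simp only [sub_self, Real.rpow_zero, one_mul] at h
  have hI : Integrable (fun q : ℝ × ℝ => igDensity k q.1 q.2 * w q.2)
      ((gaussianReal m v).prod (volume.restrict (Ioi 0))) :=
    h.mul_bdd (c := 1) (hw.comp measurable_snd).aestronglyMeasurable (.of_forall fun q => hb _)
  refine ⟨hI.integral_prod_left, ?_⟩
  rw [integral_integral_swap (f := fun (y t : ℝ) => igDensity k y t * w t) hI]
  simp_rw [integral_mul_const]
  rfl

/-- Nor does the factor depend on `y`, so the bound survives averaging over the log-normal factor.
-/
theorem abs_integral_mixDensity_normalProb_cos_le (hk : 0 < k) (V : ℝ) {B : Set ℝ}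
    (hB : MeasurableSet B) :
    |∫ t in Ioi (0 : ℝ), mixDensity k m v t * Real.cos (V * Real.log t) * normalProb B t|
      ≤ gammaRatio k V * ∫ t in Ioi (0 : ℝ), mixDensity k m v t * normalProb B t := by
  have hN : ∀ t, |normalProb B t| ≤ 1 := fun t => by
    rw [abs_of_nonneg (normalProb_nonneg B t)]; exact normalProb_le_one B t
  have hcos : Measurable fun t : ℝ => Real.cos (V * Real.log t) := by fun_prop
  obtain ⟨i1, h1⟩ := integral_mixDensity_mul (m := m) (v := v) hk (measurable_normalProb hB) hN
  obtain ⟨i2, h2⟩ := integral_mixDensity_mul (m := m) (v := v) hk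
    (hcos.mul (measurable_normalProb hB)) fun t => by
      rw [Pi.mul_apply, abs_mul]
      exact mul_le_one₀ (Real.abs_cos_le_one _) (abs_nonneg _) (hN t)
  simp only [Pi.mul_apply, ← mul_assoc] at i2 h2
  rw [h1, h2, ← integral_const_mul]
  refine (abs_integral_le_integral_abs).trans (integral_mono i2.abs (i1.const_mul _) fun y => ?_)
  exact abs_integral_igDensity_normalProb_cos_le hk y V B

end Oscillation

/-! ### The oscillating perturbation -/

/-- The mean of `cos (V log T)`, where `T` has density `p`. -/
def cosMean (p : ℝ → ℝ) (V : ℝ) : ℝ := ∫ t in Ioi (0 : ℝ), p t * Real.cos (V * Real.log t)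

/-- The density `p` modulated by an oscillation of log-frequency `V` and relative amplitude `δ`. -/
def perturbed (p : ℝ → ℝ) (V δ t : ℝ) : ℝ :=
  p t * (1 + δ * Real.cos (V * Real.log t)) / (1 + δ * cosMean p V)

@[simp]
theorem perturbed_zero (p : ℝ → ℝ) (V : ℝ) : perturbed p V 0 = p := by
  funext t; simp [perturbed]

theorem gammaRatio_nonneg {k : ℕ} (V : ℝ) : 0 ≤ gammaRatio k V :=
  div_nonneg (norm_nonneg _) (Real.Gamma_nonneg_of_nonneg (by positivity))

theorem integrableOn_mul_cos {p : ℝ → ℝ} (hp : IntegrableOn p (Ioi 0)) (V : ℝ) :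
    IntegrableOn (fun t => p t * Real.cos (V * Real.log t)) (Ioi 0) :=
  Integrable.mul_bdd (c := 1) hp (by fun_prop : Measurable fun t : ℝ =>
    Real.cos (V * Real.log t)).aestronglyMeasurable (.of_forall fun _ => Real.abs_cos_le_one _)

/-- Euler's formula in the form `cos (V log t) = (t ^ (iV) + t ^ (-iV)) / 2`: modulation by the
cosine shifts the Mellin transform by `± iV`. -/
theorem ofReal_mul_cos_log (a V : ℝ) {t : ℝ} (ht : 0 < t) :
    ((a * Real.cos (V * Real.log t) : ℝ) : ℂ)
      = (1 / 2 : ℂ) • ((t : ℂ) ^ (V * Complex.I) • (a : ℂ) + (t : ℂ) ^ (-(V * Complex.I)) • (a : ℂ)) := by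
  have ht0 : (t : ℂ) ≠ 0 := Complex.ofReal_ne_zero.2 ht.ne'
  rw [Complex.cpow_def_of_ne_zero ht0, Complex.cpow_def_of_ne_zero ht0, ← Complex.ofReal_log ht.le,
    Complex.ofReal_mul, Complex.ofReal_cos, Complex.cos]
  simp only [smul_eq_mul]
  push_cast
  rw [show (V : ℂ) * Real.log t * Complex.I = Real.log t * (V * Complex.I) by ring,
    show -((V : ℂ) * Real.log t) * Complex.I = Real.log t * -(V * Complex.I) by ring]
  ring

theorem hasMellin_perturbed {p : ℝ → ℝ} {V δ : ℝ} {z : ℂ}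
    (h0 : MellinConvergent (fun t => (p t : ℂ)) z)
    (h1 : MellinConvergent (fun t => (p t : ℂ)) (z + V * Complex.I))
    (h2 : MellinConvergent (fun t => (p t : ℂ)) (z + -(V * Complex.I))) :
    HasMellin (fun t => (perturbed p V δ t : ℂ)) z
      ((mellinOf p z + δ * ((1 / 2) * (mellinOf p (z + V * Complex.I)
        + mellinOf p (z + -(V * Complex.I))))) / ((1 + δ * cosMean p V : ℝ) : ℂ)) := by
  have c1 := MellinConvergent.cpow_smul.2 h1
  have c2 := MellinConvergent.cpow_smul.2 h2
  have a1 := hasMellin_add c1 c2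
  have a2 := hasMellin_const_smul a1.1 (1 / 2 : ℂ)
  have a3 := hasMellin_const_smul a2.1 (δ : ℂ)
  have a4 := hasMellin_add h0 a3.1
  have e : ∀ t ∈ Ioi (0 : ℝ), (perturbed p V δ t : ℂ)
      = ((p t : ℂ) + (δ : ℂ) • ((1 / 2 : ℂ) • ((t : ℂ) ^ (V * Complex.I) • (p t : ℂ)
        + (t : ℂ) ^ (-(V * Complex.I)) • (p t : ℂ)))) / ((1 + δ * cosMean p V : ℝ) : ℂ) :=
    fun t ht => by
      rw [← ofReal_mul_cos_log _ _ ht, perturbed, smul_eq_mul]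
      push_cast
      ring
  have e' : ∀ t ∈ Ioi (0 : ℝ), (t : ℂ) ^ (z - 1) • (perturbed p V δ t : ℂ) = (t : ℂ) ^ (z - 1) •
      (((p t : ℂ) + (δ : ℂ) • ((1 / 2 : ℂ) • ((t : ℂ) ^ (V * Complex.I) • (p t : ℂ)
        + (t : ℂ) ^ (-(V * Complex.I)) • (p t : ℂ)))) / ((1 + δ * cosMean p V : ℝ) : ℂ)) :=
    fun t ht => by rw [e t ht]
  refine ⟨(MellinConvergent.div_const a4.1 _).congr_fun (fun t ht => (e' t ht).symm)
    measurableSet_Ioi, ?_⟩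
  rw [mellin, setIntegral_congr_fun measurableSet_Ioi e', ← mellin, mellin_div_const, a4.2, a3.2,
    a2.2, a1.2, mellin_cpow_smul, mellin_cpow_smul]
  simp only [smul_eq_mul, mellinOf]

theorem isDensity_perturbed {p : ℝ → ℝ} (hc : ContinuousOn p (Ioi 0))
    (hp : ∀ t ∈ Ioi (0 : ℝ), 0 ≤ p t) (hi : IntegrableOn p (Ioi 0))
    (h1 : ∫ t in Ioi (0 : ℝ), p t = 1) {V δ : ℝ} (hδ0 : 0 ≤ δ) (hδ1 : δ ≤ 1)
    (hpos : 0 < 1 + δ * cosMean p V) :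
    IsDensity (perturbed p V δ) ∧ IntegrableOn (perturbed p V δ) (Ioi 0) := by
  have hnn : ∀ t ∈ Ioi (0 : ℝ), 0 ≤ perturbed p V δ t := fun t ht => by
    refine div_nonneg (mul_nonneg (hp t ht) ?_) hpos.le
    nlinarith [Real.neg_one_le_cos (V * Real.log t)]
  have e : perturbed p V δ
      = fun t => (p t + δ * (p t * Real.cos (V * Real.log t))) / (1 + δ * cosMean p V) := by
    funext t; rw [perturbed]; ring
  have hcos := (integrableOn_mul_cos hi V).const_mul δ
  have hint : IntegrableOn (perturbed p V δ) (Ioi 0) := by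
    rw [e]; exact (Integrable.add hi hcos).div_const _
  refine ⟨⟨?_, hnn, ?_⟩, hint⟩
  · have hlog : ContinuousOn Real.log (Ioi 0) :=
      Real.continuousOn_log.mono fun t ht => ne_of_gt ht
    exact (hc.mul (continuousOn_const.add (continuousOn_const.mul
      (Real.continuous_cos.comp_continuousOn (continuousOn_const.mul hlog))))).div_const _
  · rw [← ofReal_integral_eq_lintegral_ofReal hint]
    · rw [e, integral_div, integral_add hi hcos, integral_const_mul, h1]
      change ENNReal.ofReal ((1 + δ * cosMean p V) / (1 + δ * cosMean p V)) = 1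
      rw [div_self hpos.ne', ENNReal.ofReal_one]
    · filter_upwards [ae_restrict_mem measurableSet_Ioi] with t ht using hnn t ht

section Mix

variable {k : ℕ} {m : ℝ} {v : ℝ≥0}

/-- The damping bound with `B` the whole line, where the normal probability is one. -/
theorem abs_cosMean_mixDensity_le (hk : 0 < k) (V : ℝ) :
    |cosMean (mixDensity k m v) V| ≤ gammaRatio k V := by
  have h := abs_integral_mixDensity_normalProb_cos_le (m := m) (v := v) hk V MeasurableSet.univ
  have e : ∀ t, normalProb univ t = 1 := fun t => by simp [normalProb]
  simpa only [e, mul_one, integral_mixDensity hk] using! h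

theorem isDensity_perturbed_mixDensity (hk : 0 < k) {V δ : ℝ} (hδ0 : 0 ≤ δ) (hδ1 : δ ≤ 1)
    (hpos : 0 < 1 + δ * cosMean (mixDensity k m v) V) :
    IsDensity (perturbed (mixDensity k m v) V δ)
      ∧ IntegrableOn (perturbed (mixDensity k m v) V δ) (Ioi 0) :=
  isDensity_perturbed (continuousOn_mixDensity hk) (fun _ ht => (mixDensity_pos hk ht).le)
    (integrableOn_mixDensity hk) (integral_mixDensity hk) hδ0 hδ1 hpos

/-- With `u = δ * gammaRatio k V`, the numerator is `I (1 ± u)` by damping and the normalising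
constant is `1 ± u`. Since `u ≤ 1/2`, one has `1 + u ≤ (1 + 4u)(1 - u)`, whence the constant `4`.
The error is relative to the base law, so it controls the likelihood ratio in the tails too. -/
theorem stoppedLaw_perturbed_mixDensity (hk : 0 < k) {V δ : ℝ} (hδ0 : 0 ≤ δ) (hδ1 : δ ≤ 1)
    (hR : gammaRatio k V ≤ 1 / 2) {B : Set ℝ} (hB : MeasurableSet B) :
    stoppedLaw (perturbed (mixDensity k m v) V δ) B
        ≤ ENNReal.ofReal (1 + 4 * (δ * gammaRatio k V)) * stoppedLaw (mixDensity k m v) B ∧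
    ENNReal.ofReal (1 - 4 * (δ * gammaRatio k V)) * stoppedLaw (mixDensity k m v) B
        ≤ stoppedLaw (perturbed (mixDensity k m v) V δ) B := by
  set p := mixDensity k m v with hp
  set R := gammaRatio k V with hRdef
  have hR0 : 0 ≤ R := gammaRatio_nonneg V
  have hc := abs_le.1 (abs_cosMean_mixDensity_le (m := m) (v := v) hk V)
  rw [← hp, ← hRdef] at hc
  have hpi : IntegrableOn p (Ioi 0) := integrableOn_mixDensity hk
  have hpn : ∀ t ∈ Ioi (0 : ℝ), 0 ≤ p t := fun _ ht => (mixDensity_pos hk ht).le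
  set u := δ * R with hu
  have hu0 : 0 ≤ u := by positivity
  have hu1 : u ≤ 1 / 2 := by nlinarith
  have hd1 : 1 - u ≤ 1 + δ * cosMean p V := by nlinarith [hc.1]
  have hd2 : 1 + δ * cosMean p V ≤ 1 + u := by nlinarith [hc.2]
  have hpos : 0 < 1 + δ * cosMean p V := by linarith
  obtain ⟨hq, hqi⟩ := isDensity_perturbed_mixDensity (m := m) (v := v) hk hδ0 hδ1 hpos
  rw [stoppedLaw_apply hq.nonneg hqi hB, stoppedLaw_apply hpn hpi hB]
  set I := ∫ t in Ioi (0 : ℝ), p t * normalProb B t with hI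
  have hI0 : 0 ≤ I := setIntegral_nonneg measurableSet_Ioi fun t ht =>
    mul_nonneg (hpn t ht) (normalProb_nonneg B t)
  set J := ∫ t in Ioi (0 : ℝ), p t * Real.cos (V * Real.log t) * normalProb B t with hJ
  have hJI := abs_le.1 (abs_integral_mixDensity_normalProb_cos_le (m := m) (v := v) hk V hB)
  rw [← hp, ← hI, ← hJ, ← hRdef] at hJI
  have hNb : ∀ t, ‖normalProb B t‖ ≤ 1 := fun t => by
    rw [Real.norm_of_nonneg (normalProb_nonneg B t)]; exact normalProb_le_one B t
  have i1 : IntegrableOn (fun t => p t * normalProb B t) (Ioi 0) :=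
    Integrable.mul_bdd (c := 1) hpi (measurable_normalProb hB).aestronglyMeasurable
      (.of_forall hNb)
  have i2 : IntegrableOn (fun t => p t * Real.cos (V * Real.log t) * normalProb B t) (Ioi 0) :=
    Integrable.mul_bdd (c := 1) (integrableOn_mul_cos hpi V)
      (measurable_normalProb hB).aestronglyMeasurable (.of_forall hNb)
  have hE : ∫ t in Ioi (0 : ℝ), perturbed p V δ t * normalProb B t
      = (I + δ * J) / (1 + δ * cosMean p V) := by
    rw [hI, hJ, ← integral_const_mul, ← integral_add i1 (i2.const_mul δ), ← integral_div]
    refine integral_congr_ae (.of_forall fun t => ?_)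
    simp only [perturbed]
    ring
  have hδJ : δ * J ≤ u * I := by rw [hu, mul_assoc]; exact mul_le_mul_of_nonneg_left hJI.2 hδ0
  have hδJ' : -(u * I) ≤ δ * J := by
    rw [hu, mul_assoc, ← mul_neg]; exact mul_le_mul_of_nonneg_left hJI.1 hδ0
  rw [hE]
  constructor
  · rw [← ENNReal.ofReal_mul (by positivity)]
    refine ENNReal.ofReal_le_ofReal ?_
    rw [div_le_iff₀ hpos]
    calc I + δ * J ≤ I * (1 + u) := by linarith
      _ ≤ I * ((1 + 4 * u) * (1 - u)) := by
        refine mul_le_mul_of_nonneg_left ?_ hI0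
        nlinarith
      _ = (1 + 4 * u) * I * (1 - u) := by ring
      _ ≤ _ := mul_le_mul_of_nonneg_left hd1 (by positivity)
  · rw [← ENNReal.ofReal_mul' hI0]
    refine ENNReal.ofReal_le_ofReal ?_
    rw [le_div_iff₀ hpos]
    rcases le_total 0 (1 - 4 * u) with h | h
    · calc (1 - 4 * u) * I * (1 + δ * cosMean p V) ≤ (1 - 4 * u) * I * (1 + u) :=
            mul_le_mul_of_nonneg_left hd2 (by positivity)
        _ = I * ((1 - 4 * u) * (1 + u)) := by ring
        _ ≤ I * (1 - u) := mul_le_mul_of_nonneg_left (by nlinarith) hI0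
        _ ≤ I + δ * J := by linarith
    · have : (1 - 4 * u) * I * (1 + δ * cosMean p V) ≤ 0 :=
        mul_nonpos_of_nonpos_of_nonneg (mul_nonpos_of_nonpos_of_nonneg h hI0) hpos.le
      nlinarith

/-- The lower bound given by one oscillating perturbation. -/
theorem le_minimaxRisk_of_perturbed_mem {G : Set (ℝ → ℝ)} (hk : 0 < k) {V δ : ℝ} (hδ0 : 0 ≤ δ)
    (hδ1 : δ ≤ 1) (hR : gammaRatio k V ≤ 1 / 2) {n : ℕ} (hn0 : 0 < n)
    (hn : n * (4 * (δ * gammaRatio k V)) ^ 2 ≤ 1) (hp : mixDensity k m v ∈ G)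
    (hq : perturbed (mixDensity k m v) V δ ∈ G) :
    1 / 8 ≤ minimaxRisk G 1 n (mixDensity k m v 1 / 6 * δ) := by
  have hR0 : 0 ≤ gammaRatio k V := gammaRatio_nonneg V
  have hc := abs_le.1 (abs_cosMean_mixDensity_le (m := m) (v := v) hk V)
  have hpos : 0 < 1 + δ * cosMean (mixDensity k m v) V := by nlinarith [hc.1]
  have hdens := (isDensity_perturbed_mixDensity (m := m) (v := v) hk hδ0 hδ1 hpos).1
  have hdens0 := (isDensity_perturbed_mixDensity (m := m) (v := v) (V := 0) hk le_rfl zero_le_one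
    (by simp)).1
  rw [perturbed_zero] at hdens0
  have := hdens.isProbabilityMeasure
  have := hdens0.isProbabilityMeasure
  have hη0 : 0 ≤ 4 * (δ * gammaRatio k V) := by positivity
  have hη1 : 4 * (δ * gammaRatio k V) ≤ 1 := by
    have : (1 : ℝ) ≤ n := by exact_mod_cast hn0
    nlinarith
  refine le_minimaxRisk hp hq hη0 hη1 hn ?_
    (fun B hB => (stoppedLaw_perturbed_mixDensity hk hδ0 hδ1 hR hB).1)
    (fun B hB => (stoppedLaw_perturbed_mixDensity hk hδ0 hδ1 hR hB).2)
  have hP := mixDensity_pos (m := m) (v := v) hk one_pos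
  refine le_trans ?_ (le_abs_self _)
  rw [perturbed, Real.log_one, mul_zero, Real.cos_zero, mul_one]
  set P := mixDensity k m v 1
  set c := cosMean (mixDensity k m v) V
  have e : P * (1 + δ) / (1 + δ * c) - P = P * δ * (1 - c) / (1 + δ * c) := by
    field_simp; ring
  rw [e, le_div_iff₀ hpos]
  have hPδ : 0 ≤ P * δ := by positivity
  -- From `|c| ≤ 1/2` and `δ ≤ 1`: `1 - c ≥ 1/2` and `1 + δ c ≤ 3/2`. The separation `P δ / 3` is
  -- twice the radius `P / 6 * δ`.
  have : 1 / 3 * (1 + δ * c) ≤ 1 - c := by nlinarith [hc.1, hc.2]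
  nlinarith

end Mix

/-! ### Membership in the smoothness classes -/

/-- The transform of the perturbation combines the base transform at `w` and, with weight `δ / 2`,
at `w ± V`. On the shifted pieces `δ` pays for evaluating the weight away from the centre of the
Gaussian, so each piece is dominated by a translate of one integral. The factor `8` is `4 + 4`: a
`2` from the normalising constant and a `2` from the weight bound, once for the unshifted piece and
once for the two half-weighted shifts together. -/
theorem lintegral_perturbed_mixDensity_lt {k : ℕ} (hk : 0 < k) {v : ℝ≥0} {β γ L : ℝ}
    (hγ : γ < k + 1)
    (hL : ENNReal.ofReal (8 * (Real.Gamma (k + 1 - γ) / Real.Gamma k)) *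
      ∫⁻ w : ℝ, ENNReal.ofReal (Real.exp (-(v * w ^ 2 / 2)) * Real.exp (β * |w|))
        < ENNReal.ofReal L)
    {V δ : ℝ} (hδ0 : 0 ≤ δ)
    (hc : 1 / 2 ≤ 1 + δ * cosMean (mixDensity k (-(v * (γ - 1))) v) V)
    {ω : ℝ → ℝ} (hω0 : ∀ w, 0 ≤ ω w) (hω : ∀ w, ω w ≤ 2 * Real.exp (β * |w|))
    (hω1 : ∀ w, δ * ω (w - V) ≤ 2 * Real.exp (β * |w|))
    (hω2 : ∀ w, δ * ω (w + V) ≤ 2 * Real.exp (β * |w|)) :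
    MellinConvergent (fun t => (perturbed (mixDensity k (-(v * (γ - 1))) v) V δ t : ℂ)) γ ∧
    ∫⁻ w : ℝ, ENNReal.ofReal (‖mellinOf (perturbed (mixDensity k (-(v * (γ - 1))) v) V δ)
      (γ + w * Complex.I)‖ * ω w) < ENNReal.ofReal L := by
  have hG : 0 < Real.Gamma k := Real.Gamma_pos_of_pos (by exact_mod_cast hk)
  have hG' : 0 < Real.Gamma (k + 1 - γ) := Real.Gamma_pos_of_pos (by linarith)
  set p := mixDensity k (-(v * (γ - 1))) v with hp
  set K := Real.Gamma (k + 1 - γ) / Real.Gamma k with hK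
  have hK0 : 0 < K := by positivity
  have hconv : ∀ w : ℝ, MellinConvergent (fun t => (p t : ℂ)) (γ + w * Complex.I) := fun w =>
    (hasMellin_mixDensity hk (by simpa using hγ)).1
  have hM : ∀ w : ℝ, HasMellin (fun t => (perturbed p V δ t : ℂ)) (γ + w * Complex.I)
      ((mellinOf p (γ + w * Complex.I) + δ * ((1 / 2) * (mellinOf p (γ + (w + V : ℝ) * Complex.I)
        + mellinOf p (γ + (w - V : ℝ) * Complex.I)))) / ((1 + δ * cosMean p V : ℝ) : ℂ)) := by
    intro w
    have e1 : (γ + (w + V : ℝ) * Complex.I : ℂ) = γ + w * Complex.I + V * Complex.I := by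
      push_cast; ring
    have e2 : (γ + (w - V : ℝ) * Complex.I : ℂ) = γ + w * Complex.I + -(V * Complex.I) := by
      push_cast; ring
    rw [e1, e2]
    exact hasMellin_perturbed (hconv w) (e1 ▸ hconv (w + V)) (e2 ▸ hconv (w - V))
  refine ⟨by simpa using (hM 0).1, lt_of_le_of_lt ?_ hL⟩
  set g : ℝ → ℝ := fun w => Real.exp (-(v * w ^ 2 / 2)) with hg
  have hg0 : ∀ w, 0 < g w := fun w => Real.exp_pos _
  have hgm : Measurable g := by fun_prop
  have hb : ∀ w : ℝ, ‖mellinOf p (γ + w * Complex.I)‖ ≤ K * g w := fun w =>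
    norm_mellinOf_mixDensity_le hk hγ w
  set F : ℝ → ℝ≥0∞ := fun w => ENNReal.ofReal (g w * Real.exp (β * |w|)) with hF
  have hFm : Measurable F := by fun_prop
  set f : ℝ → ℝ → ℝ≥0∞ := fun s w =>
    ENNReal.ofReal (2 * K) * ENNReal.ofReal (g (w + s) * (2 * Real.exp (β * |w + s|))) with hf
  have hfm : ∀ s, Measurable (f s) := fun s => by fun_prop
  have hfi : ∀ s, ∫⁻ w, f s w = ENNReal.ofReal (4 * K) * ∫⁻ w, F w := fun s => by
    rw [lintegral_const_mul _ (by fun_prop),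
      lintegral_add_right_eq_self (fun w => ENNReal.ofReal (g w * (2 * Real.exp (β * |w|)))) s]
    have : ∀ w, ENNReal.ofReal (g w * (2 * Real.exp (β * |w|))) = ENNReal.ofReal 2 * F w :=
      fun w => by
        rw [hF, ← ENNReal.ofReal_mul (by norm_num)]; congr 1; ring
    simp_rw [this]
    rw [lintegral_const_mul _ hFm, ← mul_assoc, ← ENNReal.ofReal_mul (by positivity)]
    congr 2; ring
  have hpt : ∀ w : ℝ, ENNReal.ofReal (‖mellinOf (perturbed p V δ) (γ + w * Complex.I)‖ * ω w)
      ≤ f 0 w + ENNReal.ofReal (1 / 2) * (f V w + f (-V) w) := by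
    intro w
    rw [hf]
    have h2K : 0 ≤ 2 * K := by positivity
    simp only [← ENNReal.ofReal_mul h2K]
    rw [← ENNReal.ofReal_add (by positivity) (by positivity),
      ← ENNReal.ofReal_mul (by positivity), ← ENNReal.ofReal_add (by positivity) (by positivity)]
    refine ENNReal.ofReal_le_ofReal ?_
    have hN : ‖mellinOf (perturbed p V δ) (γ + w * Complex.I)‖
        ≤ 2 * (K * g w + δ * (1 / 2 * (K * g (w + V) + K * g (w - V)))) := by
      rw [mellinOf, (hM w).2, norm_div, Complex.norm_real, Real.norm_of_nonneg (by linarith)]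
      rw [div_le_iff₀ (by linarith)]
      have hA : ‖mellinOf p (γ + w * Complex.I) + δ * ((1 / 2) *
          (mellinOf p (γ + (w + V : ℝ) * Complex.I) + mellinOf p (γ + (w - V : ℝ) * Complex.I)))‖
          ≤ K * g w + δ * (1 / 2 * (K * g (w + V) + K * g (w - V))) := by
        refine (norm_add_le _ _).trans (add_le_add (hb w) ?_)
        rw [norm_mul, norm_mul, Complex.norm_real, Real.norm_of_nonneg hδ0]
        have : ‖(1 / 2 : ℂ)‖ = 1 / 2 := by norm_num
        rw [this]
        gcongr
        exact (norm_add_le _ _).trans (add_le_add (hb _) (hb _))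
      have hA0 := (norm_nonneg _).trans hA
      nlinarith
    -- The weight hypotheses are used at the translated points, so that the exponential is centred
    -- where the Gaussian is.
    have k1 : δ * ω w ≤ 2 * Real.exp (β * |w + V|) := by simpa using hω1 (w + V)
    have k2 : δ * ω w ≤ 2 * Real.exp (β * |w - V|) := by simpa using hω2 (w - V)
    calc _ ≤ 2 * (K * g w + δ * (1 / 2 * (K * g (w + V) + K * g (w - V)))) * ω w :=
          mul_le_mul_of_nonneg_right hN (hω0 w)
      _ = 2 * K * (g w * ω w) + 1 / 2 * (2 * K * (g (w + V) * (δ * ω w))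
          + 2 * K * (g (w - V) * (δ * ω w))) := by ring
      _ ≤ 2 * K * (g w * (2 * Real.exp (β * |w|)))
          + 1 / 2 * (2 * K * (g (w + V) * (2 * Real.exp (β * |w + V|)))
          + 2 * K * (g (w - V) * (2 * Real.exp (β * |w - V|)))) := by
        have := hω w
        gcongr
      _ = _ := by simp only [add_zero, sub_eq_add_neg]
  refine (lintegral_mono hpt).trans_eq ?_
  rw [lintegral_add_left (hfm 0), lintegral_const_mul _
    (show Measurable fun w => f V w + f (-V) w from (hfm V).add (hfm (-V))),
    lintegral_add_left (hfm V), hfi, hfi, hfi, ← two_mul, ← mul_assoc (ENNReal.ofReal (1 / 2))]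
  have h2 : ENNReal.ofReal (1 / 2) * 2 = 1 := by
    rw [show (2 : ℝ≥0∞) = ENNReal.ofReal 2 by simp, ← ENNReal.ofReal_mul (by norm_num)]
    norm_num
  rw [h2, one_mul, ← add_mul, ← ENNReal.ofReal_add (by positivity) (by positivity)]
  congr 2
  ring

/-- As `v → ∞` the integrand tends to zero off `w = 0`, and dominated convergence applies along `v =
n + 1`. The case `v = 1` supplies the majorant through `β |w| ≤ β ^ 2 + w ^ 2 / 4`. -/
theorem exists_variance (β K : ℝ) {L : ℝ} (hL : 0 < L) :
    ∃ v : ℝ≥0, ENNReal.ofReal K *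
      ∫⁻ w : ℝ, ENNReal.ofReal (Real.exp (-(v * w ^ 2 / 2)) * Real.exp (β * |w|))
        < ENNReal.ofReal L := by
  have hdom : ∫⁻ w : ℝ, ENNReal.ofReal (Real.exp (β ^ 2) * Real.exp (-(1 / 4) * w ^ 2)) ≠ ∞ :=
    ((integrable_exp_neg_mul_sq (b := 1 / 4) (by norm_num)).const_mul _).lintegral_lt_top.ne
  have hlim : Tendsto (fun n : ℕ => ∫⁻ w : ℝ,
      ENNReal.ofReal (Real.exp (-(((n + 1 : ℝ≥0) : ℝ) * w ^ 2 / 2)) * Real.exp (β * |w|))) atTop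
      (𝓝 (∫⁻ _ : ℝ, 0)) := by
    refine tendsto_lintegral_of_dominated_convergence
      (fun w => ENNReal.ofReal (Real.exp (β ^ 2) * Real.exp (-(1 / 4) * w ^ 2)))
      (fun n => by fun_prop) (fun n => .of_forall fun w => ?_) hdom ?_
    · refine ENNReal.ofReal_le_ofReal ?_
      rw [← Real.exp_add, ← Real.exp_add]
      refine Real.exp_le_exp.2 ?_
      have h1 : β * |w| ≤ β ^ 2 + w ^ 2 / 4 := by
        nlinarith [sq_nonneg (β - |w| / 2), sq_abs w]
      push_cast
      nlinarith [mul_nonneg (n.cast_nonneg : (0 : ℝ) ≤ n) (sq_nonneg w)]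
    · have h0 : ∀ᵐ w : ℝ, w ≠ 0 := by simp [ae_iff]
      filter_upwards [h0] with w hw
      rw [← ENNReal.ofReal_zero]
      refine ENNReal.tendsto_ofReal ?_
      have h1 : Tendsto (fun n : ℕ => ((n + 1 : ℝ≥0) : ℝ) * w ^ 2 / 2) atTop atTop := by
        have hw2 : 0 < w ^ 2 / 2 := by positivity
        have h2 : Tendsto (fun n : ℕ => (n : ℝ) + 1) atTop atTop :=
          tendsto_atTop_add_const_right _ _ tendsto_natCast_atTop_atTop
        refine (h2.atTop_mul_const hw2).congr fun n => ?_
        push_cast; ring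
      simpa using (Real.tendsto_exp_neg_atTop_nhds_zero.comp h1).mul_const (Real.exp (β * |w|))
  rw [lintegral_zero] at hlim
  have h3 := ENNReal.Tendsto.const_mul (a := ENNReal.ofReal K) hlim (Or.inr ENNReal.ofReal_ne_top)
  rw [mul_zero] at h3
  obtain ⟨n, hn⟩ := (h3.eventually (gt_mem_nhds (ENNReal.ofReal_pos.2 hL))).exists
  exact ⟨n + 1, hn⟩

theorem rpow_le_exp_mul {β : ℝ} (hβ : 0 ≤ β) (u : ℝ) : (1 + |u|) ^ β ≤ Real.exp (β * |u|) := by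
  rw [mul_comm, Real.exp_mul]
  exact Real.rpow_le_rpow (by positivity) (by linarith [Real.add_one_le_exp |u|]) hβ

theorem one_add_rpow_le {β : ℝ} (hβ : 0 ≤ β) (w : ℝ) : 1 + |w| ^ β ≤ 2 * Real.exp (β * |w|) := by
  have h1 : |w| ^ β ≤ (1 + |w|) ^ β :=
    Real.rpow_le_rpow (abs_nonneg w) (by linarith) hβ
  have h2 := Real.one_le_exp (mul_nonneg hβ (abs_nonneg w))
  linarith [rpow_le_exp_mul hβ w]

/-- For `V ≥ 1` and `|s| ≤ V`, `|w + s| ≤ V (1 + |w|)`: a shift by `s` costs the polynomial weight a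
factor `V ^ β`. -/
theorem rpow_neg_mul_one_add_rpow_le {β V s : ℝ} (hβ : 0 ≤ β) (hV : 1 ≤ V) (hs : |s| ≤ V) (w : ℝ) :
    V ^ (-β) * (1 + |w + s| ^ β) ≤ 2 * Real.exp (β * |w|) := by
  have hV0 : 0 < V := by linarith
  have h1 : |w + s| ^ β ≤ V ^ β * Real.exp (β * |w|) := by
    calc |w + s| ^ β ≤ (V * (1 + |w|)) ^ β := by
          refine Real.rpow_le_rpow (abs_nonneg _) ?_ hβ
          nlinarith [abs_add_le w s, abs_nonneg w]
      _ = V ^ β * (1 + |w|) ^ β := Real.mul_rpow hV0.le (by positivity)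
      _ ≤ _ := by gcongr; exact rpow_le_exp_mul hβ w
  have h2 : 1 ≤ V ^ β * Real.exp (β * |w|) := by
    have a := Real.one_le_rpow hV hβ
    have b := Real.one_le_exp (mul_nonneg hβ (abs_nonneg w))
    nlinarith
  rw [Real.rpow_neg hV0.le, inv_mul_le_iff₀ (by positivity)]
  linarith

theorem mul_exp_abs_add_le {β V δ s : ℝ} (hβ : 0 ≤ β) (hδV : δ ≤ Real.exp (-(β * V)))
    (hs : |s| ≤ V) (w : ℝ) : δ * Real.exp (β * |w + s|) ≤ 2 * Real.exp (β * |w|) := by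
  have h1 : β * |w + s| ≤ β * V + β * |w| := by
    have := mul_le_mul_of_nonneg_left ((abs_add_le w s).trans (add_le_add_right hs _)) hβ
    linarith
  calc δ * Real.exp (β * |w + s|)
      ≤ Real.exp (-(β * V)) * Real.exp (β * V + β * |w|) := by gcongr
    _ = Real.exp (β * |w|) := by rw [← Real.exp_add]; congr 1; ring
    _ ≤ _ := by linarith [Real.exp_pos (β * |w|)]

theorem natCast_mul_sq_le_one {n : ℕ} (hn : 0 < n) {u : ℝ} (hu0 : 0 ≤ u)
    (hu : u ≤ Real.exp (-(Real.log n / 2))) : n * u ^ 2 ≤ 1 := by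
  have hn' : (0 : ℝ) < n := by exact_mod_cast hn
  have h1 : u ^ 2 ≤ Real.exp (-(Real.log n / 2)) ^ 2 := by gcongr
  have h2 : Real.exp (-(Real.log n / 2)) ^ 2 = (n : ℝ)⁻¹ := by
    rw [← Real.exp_nat_mul, ← Real.exp_log (inv_pos.2 hn'), Real.log_inv]
    congr 1; push_cast; ring
  rw [h2] at h1
  calc n * u ^ 2 ≤ n * (n : ℝ)⁻¹ := by gcongr
    _ = 1 := mul_inv_cancel₀ hn'.ne'

/-! ### Choice of frequency and amplitude, and the rates -/

section Rates

variable {k : ℕ} {v : ℝ≥0} {β γ L : ℝ}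

/-- The base density is the perturbation of amplitude zero, so one estimate serves both hypotheses.
-/
theorem mixDensity_mem_of_perturbed (hk : 0 < k) {ω : ℝ → ℝ} {m : ℝ}
    (h : MellinConvergent (fun t => (perturbed (mixDensity k m v) 0 0 t : ℂ)) γ ∧
      ∫⁻ w : ℝ, ENNReal.ofReal (‖mellinOf (perturbed (mixDensity k m v) 0 0)
        (γ + w * Complex.I)‖ * ω w) < ENNReal.ofReal L) :
    IsDensity (mixDensity k m v) ∧ MellinConvergent (fun t => (mixDensity k m v t : ℂ)) γ ∧
      ∫⁻ w : ℝ, ENNReal.ofReal (‖mellinOf (mixDensity k m v) (γ + w * Complex.I)‖ * ω w)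
        < ENNReal.ofReal L := by
  have hd := (isDensity_perturbed_mixDensity (k := k) (m := m) (v := v) (V := 0) hk le_rfl
    zero_le_one (by simp)).1
  rw [perturbed_zero] at h hd
  exact ⟨hd, h⟩

/-- The lower bound from an oscillating perturbation, for a class of densities given by a weight on
the Mellin transform. -/
theorem le_minimaxRisk_of_weight (hk : 0 < k) (hγ : γ < k + 1)
    (hL : ENNReal.ofReal (8 * (Real.Gamma (k + 1 - γ) / Real.Gamma k)) *
      ∫⁻ w : ℝ, ENNReal.ofReal (Real.exp (-(v * w ^ 2 / 2)) * Real.exp (β * |w|))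
        < ENNReal.ofReal L)
    {ω : ℝ → ℝ} (hω0 : ∀ w, 0 ≤ ω w) (hω : ∀ w, ω w ≤ 2 * Real.exp (β * |w|))
    {V δ : ℝ} (hV : 0 ≤ V) (hδ0 : 0 ≤ δ) (hδ1 : δ ≤ 1)
    (hωV : ∀ s, |s| ≤ V → ∀ w, δ * ω (w + s) ≤ 2 * Real.exp (β * |w|))
    (hR : gammaRatio k V ≤ 1 / 2) {n : ℕ} (hn0 : 0 < n)
    (hn : 4 * (δ * gammaRatio k V) ≤ Real.exp (-(Real.log n / 2))) :
    1 / 8 ≤ minimaxRisk {p | IsDensity p ∧ MellinConvergent (fun t => (p t : ℂ)) (γ : ℂ) ∧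
      ∫⁻ w : ℝ, ENNReal.ofReal (‖mellinOf p (γ + w * Complex.I)‖ * ω w) < ENNReal.ofReal L}
      1 n (mixDensity k (-(v * (γ - 1))) v 1 / 6 * δ) := by
  have hR0 : 0 ≤ gammaRatio k V := gammaRatio_nonneg V
  have hc := abs_le.1 (abs_cosMean_mixDensity_le (m := -(v * (γ - 1))) (v := v) hk V)
  have hpos : 1 / 2 ≤ 1 + δ * cosMean (mixDensity k (-(v * (γ - 1))) v) V := by
    nlinarith [hc.1]
  refine le_minimaxRisk_of_perturbed_mem hk hδ0 hδ1 hR hn0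
    (natCast_mul_sq_le_one hn0 (by positivity) hn) ?_ ?_
  · refine mixDensity_mem_of_perturbed hk (lintegral_perturbed_mixDensity_lt hk hγ hL le_rfl
      (by norm_num) hω0 hω (fun w => ?_) (fun w => ?_)) <;>
    · rw [zero_mul]; positivity
  · exact ⟨(isDensity_perturbed_mixDensity hk hδ0 hδ1 (by linarith)).1,
      lintegral_perturbed_mixDensity_lt hk hγ hL hδ0 hpos hω0 hω
        (fun w => by rw [sub_eq_add_neg]; exact hωV (-V) (by rw [abs_neg, abs_of_nonneg hV]) w)
        (hωV V (by rw [abs_of_nonneg hV]))⟩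

theorem tendsto_const_mul_pow_mul_exp_neg (A : ℝ) (k : ℕ) {b : ℝ} (hb : 0 < b) :
    Tendsto (fun V : ℝ => A * (V ^ k * Real.exp (-(b * V)))) atTop (𝓝 0) := by
  have h := (tendsto_rpow_mul_exp_neg_mul_atTop_nhds_zero k b hb).const_mul A
  rw [mul_zero] at h
  simpa only [Real.rpow_natCast, neg_mul] using h

theorem eventually_gammaRatio_le (k : ℕ) : ∀ᶠ V in atTop, gammaRatio k V ≤ 1 / 2 := by
  obtain ⟨C, -, h⟩ := exists_gammaRatio_le k
  filter_upwards [eventually_ge_atTop 1, (tendsto_const_mul_pow_mul_exp_neg C k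
    (half_pos Real.pi_pos)).eventually (ge_mem_nhds (by norm_num : (0 : ℝ) < 1 / 2))] with V hV h2
  refine (h V hV).trans (le_trans (le_of_eq ?_) h2)
  rw [mul_assoc, div_mul_eq_mul_div]

theorem eventually_le_minimaxRisk_classC (hk : 0 < k) (hβ : 0 < β) (hγ : γ < k + 1)
    (hL : ENNReal.ofReal (8 * (Real.Gamma (k + 1 - γ) / Real.Gamma k)) *
      ∫⁻ w : ℝ, ENNReal.ofReal (Real.exp (-(v * w ^ 2 / 2)) * Real.exp (β * |w|))
        < ENNReal.ofReal L) :
    ∀ᶠ n : ℕ in atTop, 1 / 8 ≤ minimaxRisk (classC β γ L) 1 n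
      (mixDensity k (-(v * (γ - 1))) v 1 / 6 * (n : ℝ) ^ (-(β / (Real.pi + 2 * β)))
        * Real.log n ^ (-((k : ℝ) + 1))) := by
  obtain ⟨C, hC, hCb⟩ := exists_gammaRatio_le k
  have hlog : Tendsto (fun n : ℕ => Real.log n) atTop atTop :=
    Real.tendsto_log_atTop.comp tendsto_natCast_atTop_atTop
  have hD : 1 ≤ Real.pi + 2 * β := by linarith [Real.pi_gt_three]
  have hD0 : 0 < Real.pi + 2 * β := by linarith
  have hVt : Tendsto (fun n : ℕ => Real.log n / (Real.pi + 2 * β)) atTop atTop :=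
    hlog.atTop_div_const hD0
  filter_upwards [eventually_gt_atTop 0, hlog.eventually_ge_atTop (max 1 (4 * C)),
    hVt.eventually_ge_atTop 1, hVt.eventually (eventually_gammaRatio_le k)] with n hn0 hl hV hR
  have hn' : (0 : ℝ) < n := by exact_mod_cast hn0
  set l := Real.log n with hldef
  -- This frequency balances class membership, `δ ≤ e^{-βV}`, against indistinguishability, which
  -- asks `δ V ^ k e^{-πV/2}` to be of order `n^{-1/2}`.
  set V := l / (Real.pi + 2 * β) with hVdef
  have hl1 : 1 ≤ l := (le_max_left _ _).trans hl
  have hl4 : 4 * C ≤ l := (le_max_right _ _).trans hl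
  have hl0 : 0 < l := by linarith
  have hV0 : 0 < V := by linarith
  have hVl : V ≤ l := div_le_self hl0.le hD
  have hexp : (n : ℝ) ^ (-(β / (Real.pi + 2 * β))) = Real.exp (-(β * V)) := by
    rw [Real.rpow_def_of_pos hn', ← hldef, hVdef]
    congr 1; ring
  -- Of the `k + 1` logarithms, `k` absorb the factor `V ^ k` and the last absorbs the constant `4 *
  -- C`.
  set r := l ^ (-((k : ℝ) + 1)) with hr
  have hr0 : 0 < r := Real.rpow_pos_of_pos hl0 _
  have hr1 : r ≤ 1 := Real.rpow_le_one_of_one_le_of_nonpos hl1 (by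
    have := (k.cast_nonneg : (0 : ℝ) ≤ k); linarith)
  have hrl : r * l ^ k * l = 1 := by
    rw [hr, Real.rpow_neg hl0.le, Real.rpow_add_one hl0.ne', Real.rpow_natCast, mul_assoc]
    exact inv_mul_cancel₀ (by positivity)
  have hδV : Real.exp (-(β * V)) * r ≤ Real.exp (-(β * V)) :=
    mul_le_of_le_one_right (Real.exp_pos _).le hr1
  have hδ1 : Real.exp (-(β * V)) * r ≤ 1 :=
    hδV.trans (Real.exp_le_one_iff.2 (by nlinarith))
  have hδ0 : 0 ≤ Real.exp (-(β * V)) * r := by positivity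
  rw [mul_assoc, hexp]
  refine le_minimaxRisk_of_weight hk hγ hL (ω := fun w => Real.exp (β * |w|))
    (fun w => (Real.exp_pos _).le) (fun w => by linarith [Real.exp_pos (β * |w|)]) hV0.le hδ0 hδ1
    (fun s hs w => mul_exp_abs_add_le hβ.le hδV hs w) hR hn0 ?_
  rw [← hldef]
  have he : Real.exp (-(β * V)) * Real.exp (-(Real.pi * V / 2)) = Real.exp (-(l / 2)) := by
    rw [← Real.exp_add]
    congr 1
    rw [hVdef]; field_simp; ring
  calc 4 * (Real.exp (-(β * V)) * r * gammaRatio k V)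
      ≤ 4 * (Real.exp (-(β * V)) * r * (C * V ^ k * Real.exp (-(Real.pi * V / 2)))) := by
        gcongr; exact hCb V hV
    _ = 4 * C * (r * V ^ k) * (Real.exp (-(β * V)) * Real.exp (-(Real.pi * V / 2))) := by ring
    _ = 4 * C * (r * V ^ k) * Real.exp (-(l / 2)) := by rw [he]
    _ ≤ l * (r * l ^ k) * Real.exp (-(l / 2)) := by gcongr
    _ = Real.exp (-(l / 2)) := by
      rw [mul_comm l, hrl, one_mul]

/-- At `V = log n` the damping `e^{-πV/2}` beats `n^{-1/2}` by the power `n^{-(π-1)/2}`, which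
absorbs `4 * C * V ^ k`. Thus `δ = V^{-β}` needs no further logarithmic loss. -/
theorem eventually_le_minimaxRisk_classD (hk : 0 < k) (hβ : 0 < β) (hγ : γ < k + 1)
    (hL : ENNReal.ofReal (8 * (Real.Gamma (k + 1 - γ) / Real.Gamma k)) *
      ∫⁻ w : ℝ, ENNReal.ofReal (Real.exp (-(v * w ^ 2 / 2)) * Real.exp (β * |w|))
        < ENNReal.ofReal L) :
    ∀ᶠ n : ℕ in atTop, 1 / 8 ≤ minimaxRisk (classD β γ L) 1 n
      (mixDensity k (-(v * (γ - 1))) v 1 / 6 * Real.log n ^ (-β)) := by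
  obtain ⟨C, hC, hCb⟩ := exists_gammaRatio_le k
  have hlog : Tendsto (fun n : ℕ => Real.log n) atTop atTop :=
    Real.tendsto_log_atTop.comp tendsto_natCast_atTop_atTop
  have hb : 0 < (Real.pi - 1) / 2 := by linarith [Real.pi_gt_three]
  filter_upwards [eventually_gt_atTop 0, hlog.eventually_ge_atTop 1,
    hlog.eventually (eventually_gammaRatio_le k),
    hlog.eventually ((tendsto_const_mul_pow_mul_exp_neg (4 * C) k hb).eventually
      (ge_mem_nhds one_pos))] with n hn0 hl1 hR hsmall
  set l := Real.log n with hldef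
  have hl0 : 0 < l := by linarith
  have hδ0 : 0 ≤ l ^ (-β) := by positivity
  have hδ1 : l ^ (-β) ≤ 1 := Real.rpow_le_one_of_one_le_of_nonpos hl1 (by linarith)
  refine le_minimaxRisk_of_weight hk hγ hL (ω := fun w => 1 + |w| ^ β)
    (fun w => by positivity) (one_add_rpow_le hβ.le) hl0.le hδ0 hδ1
    (fun s hs w => rpow_neg_mul_one_add_rpow_le hβ.le hl1 hs w) hR hn0 ?_
  rw [← hldef]
  calc 4 * (l ^ (-β) * gammaRatio k l)
      ≤ 4 * (1 * (C * l ^ k * Real.exp (-(Real.pi * l / 2)))) := by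
        have := gammaRatio_nonneg (k := k) l
        gcongr; exact hCb l hl1
    _ = 4 * C * (l ^ k * Real.exp (-((Real.pi - 1) / 2 * l))) * Real.exp (-(l / 2)) := by
        rw [show -(Real.pi * l / 2) = -((Real.pi - 1) / 2 * l) + -(l / 2) by ring, Real.exp_add]
        ring
    _ ≤ 1 * Real.exp (-(l / 2)) := by gcongr
    _ = _ := one_mul _

end Rates

end SkorohodLowerBound

end

open SkorohodLowerBound in
theorem theorem4 (β γ L : ℝ) (hβ : 1 < β) (hγ : 0 < γ) (hL : 0 < L) :
    ∃ ε > (0 : ℝ), ∃ x > (0 : ℝ), ∃ ρ > (0 : ℝ),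
      0 < Filter.liminf (fun n : ℕ => minimaxRisk (classC β γ L) x n
          (ε * (n : ℝ) ^ (-(β / (Real.pi + 2 * β))) * Real.log n ^ (-ρ))) Filter.atTop ∧
      0 < Filter.liminf (fun n : ℕ => minimaxRisk (classD β γ L) x n
          (ε * Real.log n ^ (-β))) Filter.atTop := by
  -- A shape above `γ` puts the line `Re z = γ` inside the half-plane `Re z < k + 1` of convergence.
  obtain ⟨k, hk⟩ := exists_nat_gt γ
  have hk0 : 0 < k := by exact_mod_cast hγ.trans hk
  have hβ0 : 0 < β := by linarith
  obtain ⟨v, hv⟩ := exists_variance β (8 * (Real.Gamma (k + 1 - γ) / Real.Gamma k)) hL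
  have hpos : (0 : ENNReal) < 1 / 8 := by simp
  refine ⟨mixDensity k (-(v * (γ - 1))) v 1 / 6, div_pos (mixDensity_pos hk0 one_pos) (by norm_num),
    1, one_pos, k + 1, by positivity, ?_, ?_⟩
  · exact hpos.trans_le (Filter.le_liminf_of_le (by isBoundedDefault)
      (eventually_le_minimaxRisk_classC hk0 hβ0 (by linarith) hv))
  · exact hpos.trans_le (Filter.le_liminf_of_le (by isBoundedDefault)
      (eventually_le_minimaxRisk_classD hk0 hβ0 (by linarith) hv))
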